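/- **Corollary (Kac exact sequence).** Let $k$ be a field and let $(G,F,\rhd,\lhd)$ be a matched pair of finite groups, i.e. a left action $\rhd$ of $G$ on the set $F$ and a right action $\lhd$ of $F$ on the set $G$ with $s\rhd xy=(s\rhd x)((s\lhd x)\rhd y)$ and $st\lhd x=(s\lhd(t\rhd x))(t\lhd x)$. Let $\Sigma=F\bowtie G$ be the group $F\times G$ with product $(x,s)(y,t)=(x(s\rhd y),(s\lhd y)t)$. Let $X=F\sqcup G$ be the left $\Sigma$-set in which $(f,g)$ acts on $F$ by $x\mapsto f(g\rhd x)$ and on $G$ by the inverse of the right action $s\mapsto (s\lhd f)g$. Let $\Lambda_X$ be the kernel of the augmentation $\mathbb Z[X]\to\mathbb Z$. Let $k^\times$ be a trivial module, and put $H^n(\Gamma,k^\times)=\operatorname{Ext}^n_{\mathbb Z\Gamma}(\mathbb Z,k^\times)$ and $H^n_{\mathscr A}(\Sigma,X;k^\times)=\operatorname{Ext}^{n-1}_{\mathbb Z\Sigma}(\Lambda_X,k^\times)$ for $n\ge1$. Let $\operatorname{Opext}(kF,k^G)$ be the group of equivalence classes of the abelian extensions $k^G\to k^G\#_{\sigma,\tau}kF\to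 kF$. Here $\sigma\colon G\times F\times F\to k^\times$ and $\tau\colon G\times G\times F\to k^\times$ are normalized $2$-cocycles $\sigma\in Z^2(F,(k^G)^\times)$, $\tau\in Z^2(G,(k^F)^\times)$ with $$\sigma(st;x,y)\,\tau(s,t;xy)=\sigma(s;t\rhd x,(t\lhd x)\rhd y)\,\sigma(t;x,y)\,\tau(s,t;x)\,\tau(s\lhd(t\rhd x),t\lhd x;y),$$ and $k^G\#_{\sigma,\tau}kF$ has basis $e_s\#x$, product $(e_s\#x)(e_t\#y)=\delta_{s\lhd x,t}\,\sigma(s;x,y)\,e_s\#xy$ and coproduct $\Delta(e_s\#x)=\sum_{s=ab}\tau(a,b;x)\,(e_a\#(b\rhd x))\otimes(e_b\#x)$. The maps of the extension are $e_s\mapsto e_s\#1$ and $e_s\#x\mapsto\delta_{s,1}x$. Two extensions are equivalent if a homomorphism of Hopf algebras between the middle terms is compatible with the maps from $k^G$ and to $kF$. The group law is the Baer product, induced by the pointwise product of the pairs $(\sigma,\tau)$. Then $\operatorname{Opext}(kF,k^G)\cong H^3_{\mathscr A}(\Sigma,X;k^\times)$, and with this identification there is an exact sequence $$\begin{aligned}0&\to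 H^1(\Sigma,k^\times)\to H^1(F,k^\times)\oplus H^1(G,k^\times)\to H^2_{\mathscr A}(\Sigma,X;k^\times)\\&\to H^2(\Sigma,k^\times)\to H^2(F,k^\times)\oplus H^2(G,k^\times)\to\operatorname{Opext}(kF,k^G)\\&\to H^3(\Sigma,k^\times)\to H^3(F,k^\times)\oplus H^3(G,k^\times)\to H^4_{\mathscr A}(\Sigma,X;k^\times).\end{aligned}$$ The maps are those of the long exact $\operatorname{Ext}_{\mathbb Z\Sigma}(-,k^\times)$-sequence of $0\to\Lambda_X\to\mathbb Z[X]\to\mathbb Z\to0$, where for all $n\geq 0$ the group $\operatorname{Ext}^n_{\mathbb Z\Sigma}(\mathbb Z[X],k^\times)$ is identified with $H^n(F,k^\times)\oplus H^n(G,k^\times)$ by the Shapiro isomorphism (restriction to the stabilizers $F$, $G$ of the points $1\in G$, $1\in F$ of $X$, and pullback along $\mathbb Z\to\mathbb Z[X]$ onto these points). In particular $H^n(\Sigma,k^\times)\to H^n(F,k^\times)\oplus H^n(G,k^\times)$ is restriction. -/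

import Mathlib

open CategoryTheory CategoryTheory.Abelian
open scoped TensorProduct

universe u

noncomputable section

/-! ### Matched pairs of groups -/

/-- A matched pair of groups `(G, F, ▷, ◁)`: `actF s x = s ▷ x` is a left action of `G` on the set
`F` and `actG s x = s ◁ x` is a right action of `F` on the set `G`. -/
structure MatchedPair (G F : Type u) [Group G] [Group F] where
  actF : G → F → F
  actG : G → F → G
  one_actF : ∀ x, actF 1 x = x
  mul_actF : ∀ s t x, actF (s * t) x = actF s (actF t x)
  actG_one : ∀ s, actG s 1 = s
  actG_mul : ∀ s x y, actG s (x * y) = actG (actG s x) y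
  actF_mul : ∀ s x y, actF s (x * y) = actF s x * actF (actG s x) y
  mul_actG : ∀ s t x, actG (s * t) x = actG s (actF t x) * actG t x

namespace MatchedPair

variable {G F : Type u} [Group G] [Group F] (M : MatchedPair G F)

lemma actF_one (s : G) : M.actF s 1 = 1 := by
  have h := M.actF_mul s 1 1
  rw [mul_one, M.actG_one] at h
  exact left_eq_mul.mp h

lemma one_actG (x : F) : M.actG 1 x = 1 := by
  have h := M.mul_actG 1 1 x
  rw [mul_one, M.one_actF] at h
  exact left_eq_mul.mp h

/-- The underlying set `F × G` of the group `Σ = F ⋈ G`. -/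
@[ext]
structure Bowtie (M : MatchedPair G F) where
  fst : F
  snd : G

namespace Bowtie

variable {M}

instance : Mul M.Bowtie :=
  ⟨fun a b => ⟨a.fst * M.actF a.snd b.fst, M.actG a.snd b.fst * b.snd⟩⟩

instance : One M.Bowtie := ⟨⟨1, 1⟩⟩

instance : Inv M.Bowtie :=
  ⟨fun a => ⟨M.actF a.snd⁻¹ a.fst⁻¹, M.actG a.snd⁻¹ a.fst⁻¹⟩⟩

@[simp] lemma mul_fst (a b : M.Bowtie) : (a * b).fst = a.fst * M.actF a.snd b.fst := rfl
@[simp] lemma mul_snd (a b : M.Bowtie) : (a * b).snd = M.actG a.snd b.fst * b.snd := rfl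
@[simp] lemma one_fst : (1 : M.Bowtie).fst = 1 := rfl
@[simp] lemma one_snd : (1 : M.Bowtie).snd = 1 := rfl
@[simp] lemma inv_fst (a : M.Bowtie) : a⁻¹.fst = M.actF a.snd⁻¹ a.fst⁻¹ := rfl
@[simp] lemma inv_snd (a : M.Bowtie) : a⁻¹.snd = M.actG a.snd⁻¹ a.fst⁻¹ := rfl

/-- The group `F ⋈ G`, with product `(x, s)(y, t) = (x (s ▷ y), (s ◁ y) t)`. -/
instance : Group M.Bowtie :=
  Group.ofLeftAxioms
    (fun a b c => by
      ext
      · simp [M.actF_mul, M.mul_actF, mul_assoc]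
      · simp [M.actG_mul, M.mul_actG, mul_assoc])
    (fun a => by ext <;> simp [M.one_actF, M.one_actG])
    (fun a => by
      ext
      · simp [← M.actF_mul, M.actF_one]
      · simp [← M.actG_mul, M.actG_one])

/-- The inclusion `x ↦ (x, 1)` of `F` into `F ⋈ G`. -/
def inclF (M : MatchedPair G F) : F →* M.Bowtie where
  toFun x := ⟨x, 1⟩
  map_one' := rfl
  map_mul' x y := by ext <;> simp [M.one_actF, M.one_actG]

/-- The inclusion `s ↦ (1, s)` of `G` into `F ⋈ G`. -/
def inclG (M : MatchedPair G F) : G →* M.Bowtie where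
  toFun s := ⟨1, s⟩
  map_one' := rfl
  map_mul' x y := by ext <;> simp [M.actF_one, M.actG_one]

end Bowtie

/-- The set `X = F ⊔ G`. -/
inductive X (M : MatchedPair G F) : Type u
  | ofF (x : F) : X M
  | ofG (s : G) : X M

/-- The left action of `F ⋈ G` on `X = F ⊔ G`: on `F` it is `(f, g) x = f (g ▷ x)`, and on `G` it is
the right action `s (f, g) = (s ◁ f) g` turned into a left action by means of the inverse. -/
instance : MulAction M.Bowtie M.X where
  smul a p := match p with
    | .ofF x => .ofF (a.fst * M.actF a.snd x)
    | .ofG s => .ofG (M.actG s a⁻¹.fst * a⁻¹.snd)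
  one_smul p := by
    cases p with
    | ofF x => exact congrArg X.ofF (by simp [M.one_actF])
    | ofG s => exact congrArg X.ofG (by rw [inv_one]; simp [M.actG_one])
  mul_smul a b p := by
    cases p with
    | ofF x => exact congrArg X.ofF (by simp [M.actF_mul, M.mul_actF, mul_assoc])
    | ofG s =>
      refine congrArg X.ofG ?_
      rw [mul_inv_rev, Bowtie.mul_fst, Bowtie.mul_snd, M.actG_mul, M.mul_actG, mul_assoc]

lemma smul_ofF (a : M.Bowtie) (x : F) : a • (X.ofF x : M.X) = .ofF (a.fst * M.actF a.snd x) := rfl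

lemma smul_ofG (a : M.Bowtie) (s : G) :
    a • (X.ofG s : M.X) = .ofG (M.actG s a⁻¹.fst * a⁻¹.snd) := rfl

lemma inclG_smul (s : G) : Bowtie.inclG M s • (X.ofF 1 : M.X) = .ofF 1 := by
  rw [smul_ofF]
  simp [Bowtie.inclG, M.actF_one]

lemma inclF_smul (x : F) : Bowtie.inclF M x • (X.ofG 1 : M.X) = .ofG 1 := by
  rw [smul_ofG, ← map_inv]
  simp [Bowtie.inclF, M.one_actG]

end MatchedPair

/-! ### Cohomology of groups and relative cohomology -/

namespace GroupExt

instance enoughProjectivesRep (Γ : Type u) [Group Γ] : EnoughProjectives (Rep.{u} ℤ Γ) :=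
  Rep.equivalenceModuleMonoidAlgebra.enoughProjectives_iff.2 inferInstance

instance hasExtRep (Γ : Type u) [Group Γ] : HasExt.{u} (Rep.{u} ℤ Γ) :=
  hasExt_of_enoughProjectives _

/-- The trivial `Γ`-module `ℤ`. -/
abbrev Z (Γ : Type u) [Group Γ] : Rep.{u} ℤ Γ := Rep.trivial ℤ Γ (ULift.{u} ℤ)

/-- The group cohomology `H^n(Γ, A) = Ext^n_{ℤΓ}(ℤ, A)`. -/
abbrev H {Γ : Type u} [Group Γ] (A : Rep.{u} ℤ Γ) (n : ℕ) : Type u := Ext.{u} (Z Γ) A n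

variable (Γ : Type u) [Group Γ] (X : Type u) [MulAction Γ X]

/-- The permutation module `ℤ[X]`. -/
abbrev ZX : Rep.{u} ℤ Γ := Rep.ofMulAction ℤ Γ X

/-- The augmentation map `ℤ[X] → ℤ`, `x ↦ 1`. -/
def augmentation : ZX Γ X ⟶ Z Γ :=
  Rep.ofHom
    { toLinearMap := Finsupp.linearCombination ℤ (fun _ : X => (ULift.up 1 : ULift.{u} ℤ)) ∘ₗ
        (MonoidAlgebra.coeffLinearEquiv ℤ).toLinearMap
      isIntertwining' := fun g => by
        ext x
        simp [Representation.ofMulAction_single] }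

lemma augmentation_single (x : X) (n : ℤ) :
    (augmentation Γ X).hom (MonoidAlgebra.single x n) = ULift.up n := by
  change Finsupp.linearCombination ℤ (fun _ : X => (ULift.up 1 : ULift.{u} ℤ))
    (MonoidAlgebra.single x n).coeff = _
  rw [MonoidAlgebra.coeff_single, Finsupp.linearCombination_single]
  ext
  simp

/-- `Λ_X`, the kernel of the augmentation map. -/
abbrev Lam : Rep.{u} ℤ Γ := Limits.kernel (augmentation Γ X)

variable {Γ}

/-- The cohomology `H^n_𝒜(Γ, X; A) = Ext^{n-1}_{ℤΓ}(Λ_X, A)` of `Γ` relative to `X`, for `n ≥ 1`. -/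
abbrev HRel (A : Rep.{u} ℤ Γ) (n : ℕ) : Type u := Ext.{u} (Lam Γ X) A (n - 1)

variable (Γ)

/-- The sequence `0 → Λ_X → ℤ[X] → ℤ → 0`. -/
abbrev augSeq : ShortComplex (Rep.{u} ℤ Γ) :=
  ShortComplex.mk (Limits.kernel.ι (augmentation Γ X)) (augmentation Γ X)
    (Limits.kernel.condition _)

lemma augSeq_shortExact [Nonempty X] : (augSeq Γ X).ShortExact := by
  have : Epi (augmentation Γ X) := (Rep.epi_iff_surjective _).2 fun n =>
    ⟨MonoidAlgebra.single (Classical.arbitrary X) n.down, augmentation_single Γ X _ _⟩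
  exact { exact := ShortComplex.exact_kernel (augmentation Γ X) }

variable {Γ}

/-- The connecting homomorphism
`H^{n+1}_𝒜(Γ, X; A) = Ext^n(Λ_X, A) → Ext^{n+1}(ℤ, A) = H^{n+1}(Γ, A)` of the long exact sequence
attached to `0 → Λ_X → ℤ[X] → ℤ → 0`. -/
def conn [Nonempty X] (A : Rep.{u} ℤ Γ) (n : ℕ) : HRel X A (n + 1) →+ H A (n + 1) :=
  (augSeq_shortExact Γ X).extClass.precomp A (Nat.add_comm 1 n)

/-- The map `Ext^n(ℤ[X], A) → Ext^n(Λ_X, A) = H^{n+1}_𝒜(Γ, X; A)` induced by the inclusion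
`Λ_X → ℤ[X]`. -/
def inclPullback (A : Rep.{u} ℤ Γ) (n : ℕ) : Ext.{u} (ZX Γ X) A n →+ HRel X A (n + 1) :=
  (Ext.mk₀ (Limits.kernel.ι (augmentation Γ X))).precomp A (zero_add n)

variable {Δ : Type u} [Group Δ] (f : Δ →* Γ) (V : Type u) [AddCommGroup V]

/-- For a homomorphism `f : Δ → Γ`, the restriction `Ext^n_Γ(B, V) → Ext^n_Δ(B, V)` followed by the
pullback along a map `b : ℤ → B` of `Δ`-modules, `V` being an abelian group with trivial actions. -/
def resPullback {B : Rep.{u} ℤ Γ} (b : Z Δ ⟶ Rep.res f B) (n : ℕ) :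
    Ext.{u} B (Rep.trivial ℤ Γ V) n →+ H (Rep.trivial ℤ Δ V) n :=
  ((Ext.mk₀ b).precomp (Rep.trivial ℤ Δ V) (zero_add n)).comp
    ((Rep.resFunctor f).mapExtAddHom B (Rep.trivial ℤ Γ V) n)

/-- The restriction map `H^n(Γ, V) → H^n(Δ, V)` along `f : Δ → Γ`. -/
def resH (n : ℕ) : H (Rep.trivial ℤ Γ V) n →+ H (Rep.trivial ℤ Δ V) n :=
  resPullback f V (B := Z Γ) (𝟙 (Z Δ)) n

variable {X}

/-- The map of `Δ`-modules `ℤ → ℤ[X]`, `1 ↦ p`, where `p` is a point of `X` fixed by `Δ`. -/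
def pointMap (p : X) (hp : ∀ d, f d • p = p) : Z Δ ⟶ Rep.res f (ZX Γ X) :=
  Rep.ofHom
    { toLinearMap := (MonoidAlgebra.coeffLinearEquiv ℤ).symm.toLinearMap ∘ₗ
        Finsupp.lsingle p ∘ₗ ULift.moduleEquiv.toLinearMap
      isIntertwining' := fun d => by
        ext n
        simp [hp] }

end GroupExt

/-! ### Abelian extensions and the group `Opext` -/

namespace MatchedPair

variable {G F : Type u} [Group G] [Group F] (M : MatchedPair G F) (k : Type u) [Field k]

/-- Compatible pairs `(σ, τ)` of normalized 2-cocycles `σ ∈ Z²(F, (k^G)^×)` and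
`τ ∈ Z²(G, (k^F)^×)`, written as `σ s x y = σ(s; x, y)` and `τ s t x = τ(s, t; x)`. -/
@[ext]
structure Cocycle where
  σ : G → F → F → kˣ
  τ : G → G → F → kˣ
  σ_one_left : ∀ s x, σ s 1 x = 1
  σ_one_right : ∀ s x, σ s x 1 = 1
  τ_one_left : ∀ s x, τ 1 s x = 1
  τ_one_right : ∀ s x, τ s 1 x = 1
  σ_cocycle : ∀ s x y z, σ (M.actG s x) y z * σ s x (y * z) = σ s x y * σ s (x * y) z
  τ_cocycle : ∀ r s t x, τ (r * s) t x * τ r s (M.actF t x) = τ r (s * t) x * τ s t x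
  compat : ∀ s t x y, σ (s * t) x y * τ s t (x * y) =
    σ s (M.actF t x) (M.actF (M.actG t x) y) * σ t x y *
      (τ s t x * τ (M.actG s (M.actF t x)) (M.actG t x) y)

namespace Cocycle

variable {M k}

/-- The pointwise product `(σ, τ)(σ', τ') = (σσ', ττ')`. -/
instance : Mul (M.Cocycle k) where
  mul c d :=
    { σ := fun s x y => c.σ s x y * d.σ s x y
      τ := fun s t x => c.τ s t x * d.τ s t x
      σ_one_left := fun s x => by rw [c.σ_one_left, d.σ_one_left, mul_one]
      σ_one_right := fun s x => by rw [c.σ_one_right, d.σ_one_right, mul_one]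
      τ_one_left := fun s x => by rw [c.τ_one_left, d.τ_one_left, mul_one]
      τ_one_right := fun s x => by rw [c.τ_one_right, d.τ_one_right, mul_one]
      σ_cocycle := fun s x y z => by
        rw [mul_mul_mul_comm, c.σ_cocycle, d.σ_cocycle, mul_mul_mul_comm]
      τ_cocycle := fun r s t x => by
        rw [mul_mul_mul_comm, c.τ_cocycle, d.τ_cocycle, mul_mul_mul_comm]
      compat := fun s t x y => by
        rw [mul_mul_mul_comm, c.compat, d.compat]
        ac_rfl }

instance : One (M.Cocycle k) where
  one :=
    { σ := fun _ _ _ => 1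
      τ := fun _ _ _ => 1
      σ_one_left := fun _ _ => rfl
      σ_one_right := fun _ _ => rfl
      τ_one_left := fun _ _ => rfl
      τ_one_right := fun _ _ => rfl
      σ_cocycle := fun _ _ _ _ => rfl
      τ_cocycle := fun _ _ _ _ => rfl
      compat := fun _ _ _ _ => by simp }

instance : Inv (M.Cocycle k) where
  inv c :=
    { σ := fun s x y => (c.σ s x y)⁻¹
      τ := fun s t x => (c.τ s t x)⁻¹
      σ_one_left := fun s x => by rw [c.σ_one_left, inv_one]
      σ_one_right := fun s x => by rw [c.σ_one_right, inv_one]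
      τ_one_left := fun s x => by rw [c.τ_one_left, inv_one]
      τ_one_right := fun s x => by rw [c.τ_one_right, inv_one]
      σ_cocycle := fun s x y z => by rw [← mul_inv, c.σ_cocycle, mul_inv]
      τ_cocycle := fun r s t x => by rw [← mul_inv, c.τ_cocycle, mul_inv]
      compat := fun s t x y => by simp only [← mul_inv, c.compat] }

@[simp] lemma mul_σ (c d : M.Cocycle k) (s : G) (x y : F) :
    (c * d).σ s x y = c.σ s x y * d.σ s x y := rfl
@[simp] lemma mul_τ (c d : M.Cocycle k) (s t : G) (x : F) :
    (c * d).τ s t x = c.τ s t x * d.τ s t x := rfl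
@[simp] lemma one_σ (s : G) (x y : F) : (1 : M.Cocycle k).σ s x y = 1 := rfl
@[simp] lemma one_τ (s t : G) (x : F) : (1 : M.Cocycle k).τ s t x = 1 := rfl
@[simp] lemma inv_σ (c : M.Cocycle k) (s : G) (x y : F) : c⁻¹.σ s x y = (c.σ s x y)⁻¹ := rfl
@[simp] lemma inv_τ (c : M.Cocycle k) (s t : G) (x : F) : c⁻¹.τ s t x = (c.τ s t x)⁻¹ := rfl

instance : CommGroup (M.Cocycle k) :=
  { Group.ofLeftAxioms
      (fun a b c : M.Cocycle k => by ext <;> simp [mul_assoc])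
      (fun a => by ext <;> simp)
      (fun a => by ext <;> simp) with
    mul_comm := fun a b => by ext <;> simp [mul_comm] }

lemma one_σ_apply (c : M.Cocycle k) (x y : F) : c.σ 1 x y = 1 := by
  have h := c.compat 1 1 x y
  simp only [mul_one, M.one_actF, M.one_actG, c.τ_one_left] at h
  exact left_eq_mul.mp h

lemma τ_apply_one (c : M.Cocycle k) (s t : G) : c.τ s t 1 = 1 := by
  have h := c.compat s t 1 1
  simp only [mul_one, M.actF_one, M.actG_one, c.σ_one_left, one_mul] at h
  exact left_eq_mul.mp h

/-- The vector space `k^G #_{σ,τ} kF` with basis `e_s # x` for `s ∈ G`, `x ∈ F`. -/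
def Crossed (_c : M.Cocycle k) : Type u := (G × F) →₀ k

variable (c : M.Cocycle k)

instance : AddCommGroup c.Crossed := inferInstanceAs (AddCommGroup ((G × F) →₀ k))

instance : Module k c.Crossed := inferInstanceAs (Module k ((G × F) →₀ k))

/-- The basis `e_s # x`, indexed by `(s, x)`. -/
def basis : Module.Basis (G × F) k c.Crossed := Module.Basis.ofRepr (LinearEquiv.refl k _)

open scoped Classical in
/-- The bilinear multiplication `(e_s # x)(e_t # y) = δ_{s ◁ x, t} σ(s; x, y) e_s # xy`. -/
def mulMap : c.Crossed →ₗ[k] c.Crossed →ₗ[k] c.Crossed :=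
  c.basis.constr k fun p => c.basis.constr k fun q =>
    if M.actG p.1 p.2 = q.1 then (c.σ p.1 p.2 q.2 : k) • c.basis (p.1, p.2 * q.2) else 0

open scoped Classical in
lemma mulMap_basis (p q : G × F) : c.mulMap (c.basis p) (c.basis q) =
    if M.actG p.1 p.2 = q.1 then (c.σ p.1 p.2 q.2 : k) • c.basis (p.1, p.2 * q.2) else 0 := by
  rw [mulMap, Module.Basis.constr_basis, Module.Basis.constr_basis]

open scoped Classical in
/-- The counit `ε(e_s # x) = δ_{s, 1}`. -/
def counitMap : c.Crossed →ₗ[k] k :=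
  c.basis.constr k fun p => if p.1 = 1 then 1 else 0

open scoped Classical in
lemma counitMap_basis (p : G × F) : c.counitMap (c.basis p) = if p.1 = 1 then 1 else 0 := by
  rw [counitMap, Module.Basis.constr_basis]

instance : Mul c.Crossed := ⟨fun a b => c.mulMap a b⟩

lemma mul_def (a b : c.Crossed) : a * b = c.mulMap a b := rfl

variable {c} in
lemma crossed_induction {P : c.Crossed → Prop} (a : c.Crossed)
    (hadd : ∀ a b, P a → P b → P (a + b)) (hsmul : ∀ (r : k) a, P a → P (r • a))
    (hbasis : ∀ p, P (c.basis p)) (hzero : P 0) : P a := by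
  have ha : a ∈ Submodule.span k (Set.range c.basis) := by
    rw [c.basis.span_eq]
    trivial
  induction ha using Submodule.span_induction with
  | mem x hx =>
    obtain ⟨p, rfl⟩ := hx
    exact hbasis p
  | zero => exact hzero
  | add x y _ _ hx hy => exact hadd x y hx hy
  | smul r x _ hx => exact hsmul r x hx

lemma crossed_mul_assoc (a b d : c.Crossed) :
    c.mulMap (c.mulMap a b) d = c.mulMap a (c.mulMap b d) := by
  classical
  induction a using crossed_induction with
  | hzero => simp
  | hadd x y hx hy => simp [hx, hy]
  | hsmul r x hx => simp [hx]
  | hbasis p =>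
  induction b using crossed_induction with
  | hzero => simp
  | hadd x y hx hy => simp [hx, hy]
  | hsmul r x hx => simp [hx]
  | hbasis q =>
  induction d using crossed_induction with
  | hzero => simp
  | hadd x y hx hy => simp [hx, hy]
  | hsmul r x hx => simp [hx]
  | hbasis w =>
    obtain ⟨s, x⟩ := p
    obtain ⟨t, y⟩ := q
    obtain ⟨u, z⟩ := w
    rw [mulMap_basis, mulMap_basis]
    by_cases h1 : M.actG s x = t
    · subst h1
      by_cases h2 : M.actG (M.actG s x) y = u
      · subst h2
        simp only [if_true, map_smul, LinearMap.smul_apply, mulMap_basis, M.actG_mul, smul_smul,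
          mul_assoc, ← Units.val_mul, c.σ_cocycle]
      · simp [mulMap_basis, M.actG_mul, h2]
    · by_cases h2 : M.actG t y = u
      · simp [mulMap_basis, h1, h2]
      · simp [h1, h2]

variable [Fintype G]

/-- The comultiplication
`Δ(e_s # x) = ∑_{s = ab} τ(a, b; x) (e_a # (b ▷ x)) ⊗ (e_b # x)`, with `a = s b⁻¹`. -/
def comulMap : c.Crossed →ₗ[k] c.Crossed ⊗[k] c.Crossed :=
  c.basis.constr k fun p => ∑ b : G,
    (c.τ (p.1 * b⁻¹) b p.2 : k) • (c.basis (p.1 * b⁻¹, M.actF b p.2) ⊗ₜ[k] c.basis (b, p.2))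

lemma comulMap_basis (p : G × F) : c.comulMap (c.basis p) = ∑ b : G,
    (c.τ (p.1 * b⁻¹) b p.2 : k) • (c.basis (p.1 * b⁻¹, M.actF b p.2) ⊗ₜ[k] c.basis (b, p.2)) := by
  rw [comulMap, Module.Basis.constr_basis]

/-- The unit element is `∑_s e_s # 1`. -/
instance : One c.Crossed := ⟨∑ s : G, c.basis (s, 1)⟩

lemma one_def : (1 : c.Crossed) = ∑ s : G, c.basis (s, 1) := rfl

lemma crossed_one_mul (a : c.Crossed) : c.mulMap (1 : c.Crossed) a = a := by
  classical
  induction a using crossed_induction with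
  | hzero => simp
  | hadd x y hx hy => simp [hx, hy]
  | hsmul r x hx => simp [hx]
  | hbasis p =>
    obtain ⟨s, x⟩ := p
    simp [one_def, mulMap_basis, M.actG_one, c.σ_one_left]

lemma crossed_mul_one (a : c.Crossed) : c.mulMap a (1 : c.Crossed) = a := by
  classical
  induction a using crossed_induction with
  | hzero => simp
  | hadd x y hx hy => simp [hx, hy]
  | hsmul r x hx => simp [hx]
  | hbasis p =>
    obtain ⟨s, x⟩ := p
    simp [one_def, mulMap_basis, c.σ_one_right]

instance : Ring c.Crossed :=
  { (inferInstance : AddCommGroup c.Crossed) with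
    mul := (· * ·)
    one := 1
    left_distrib := fun a b d => (c.mulMap a).map_add b d
    right_distrib := fun a b d => by simp [mul_def]
    zero_mul := fun a => by simp [mul_def]
    mul_zero := fun a => (c.mulMap a).map_zero
    mul_assoc := fun a b d => c.crossed_mul_assoc a b d
    one_mul := c.crossed_one_mul
    mul_one := c.crossed_mul_one }

instance : Algebra k c.Crossed :=
  Algebra.ofModule (fun r a b => by simp [mul_def]) (fun r a b => by simp [mul_def])

open scoped Classical in
lemma basis_mul_basis (p q : G × F) : c.basis p * c.basis q =
    if M.actG p.1 p.2 = q.1 then (c.σ p.1 p.2 q.2 : k) • c.basis (p.1, p.2 * q.2) else 0 :=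
  c.mulMap_basis p q

instance : CoalgebraStruct k c.Crossed where
  comul := c.comulMap
  counit := c.counitMap

lemma comul_basis (p : G × F) : Coalgebra.comul (R := k) (c.basis p) = ∑ b : G,
    (c.τ (p.1 * b⁻¹) b p.2 : k) • (c.basis (p.1 * b⁻¹, M.actF b p.2) ⊗ₜ[k] c.basis (b, p.2)) :=
  c.comulMap_basis p

open scoped Classical in
lemma counit_basis (p : G × F) :
    Coalgebra.counit (R := k) (c.basis p) = if p.1 = 1 then 1 else 0 :=
  c.counitMap_basis p

instance : Coalgebra k c.Crossed where
  coassoc := by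
    refine c.basis.ext fun p => ?_
    obtain ⟨s, x⟩ := p
    simp only [LinearMap.comp_apply, comul_basis, map_sum, map_smul, LinearMap.rTensor_tmul,
      LinearMap.lTensor_tmul, TensorProduct.sum_tmul, TensorProduct.tmul_sum,
      ← TensorProduct.smul_tmul', TensorProduct.tmul_smul, LinearEquiv.coe_coe,
      TensorProduct.assoc_tmul, Finset.smul_sum, smul_smul]
    conv_rhs => rw [Finset.sum_comm]
    refine Finset.sum_congr rfl fun t _ => ?_
    refine Fintype.sum_equiv (Equiv.mulRight t) _ _ fun u => ?_
    have h := congrArg (Units.val) (c.τ_cocycle (s * t⁻¹ * u⁻¹) u t x)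
    rw [inv_mul_cancel_right, Units.val_mul, Units.val_mul] at h
    simp only [Equiv.coe_mulRight, mul_inv_rev, mul_inv_cancel_right, M.mul_actF, ← mul_assoc, h]
  rTensor_counit_comp_comul := by
    classical
    refine c.basis.ext fun p => ?_
    obtain ⟨s, x⟩ := p
    simp only [LinearMap.comp_apply, comul_basis, map_sum, map_smul, LinearMap.rTensor_tmul,
      counit_basis]
    rw [Finset.sum_eq_single s]
    · simp [c.τ_one_left]
    · intro b _ hb
      simp [mul_inv_eq_one, hb.symm]
    · simp
  lTensor_counit_comp_comul := by
    classical
    refine c.basis.ext fun p => ?_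
    obtain ⟨s, x⟩ := p
    simp only [LinearMap.comp_apply, comul_basis, map_sum, map_smul, LinearMap.lTensor_tmul,
      counit_basis]
    rw [Finset.sum_eq_single 1]
    · simp [c.τ_one_right, M.one_actF]
    · intro b _ hb
      simp [hb]
    · simp

instance : Bialgebra k c.Crossed where
  counit_one := by
    classical
    simp [one_def, counit_basis]
  mul_compr₂_counit := by
    classical
    refine c.basis.ext fun p => c.basis.ext fun q => ?_
    obtain ⟨s, x⟩ := p
    obtain ⟨t, y⟩ := q
    simp only [LinearMap.compr₂_apply, LinearMap.mul_apply', LinearMap.compl₁₂_apply,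
      basis_mul_basis, counit_basis]
    by_cases hs : s = 1
    · subst hs
      by_cases ht : t = 1
      · subst ht
        simp [M.one_actG, one_σ_apply, counit_basis]
      · simp [M.one_actG, Ne.symm ht, ht]
    · split_ifs <;> simp [counit_basis, hs]
  comul_one := by
    simp only [one_def, map_sum, comul_basis, c.τ_apply_one, M.actF_one,
      Algebra.TensorProduct.one_def, TensorProduct.sum_tmul, TensorProduct.tmul_sum,
      Units.val_one, one_smul]
    conv_lhs => rw [Finset.sum_comm]
    refine Finset.sum_congr rfl fun t _ => ?_
    exact Fintype.sum_equiv (Equiv.mulRight t⁻¹) _ _ fun u => rfl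
  mul_compr₂_comul := by
    classical
    refine c.basis.ext fun p => c.basis.ext fun q => ?_
    obtain ⟨s, x⟩ := p
    obtain ⟨t, y⟩ := q
    simp only [LinearMap.compr₂_apply, LinearMap.mul_apply', LinearMap.compl₁₂_apply,
      basis_mul_basis, comul_basis, Finset.sum_mul_sum, smul_mul_smul_comm,
      Algebra.TensorProduct.tmul_mul_tmul]
    have key : ∀ b d : G, M.actG b x = d →
        (M.actG (s * b⁻¹) (M.actF b x) = t * d⁻¹ ↔ M.actG s x = t) := by
      intro b d h
      subst h
      rw [eq_mul_inv_iff_mul_eq, ← M.mul_actG, inv_mul_cancel_right]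
    by_cases h : M.actG s x = t
    · subst h
      rw [if_pos rfl, map_smul, comul_basis, Finset.smul_sum]
      refine Finset.sum_congr rfl fun b _ => ?_
      rw [Finset.sum_eq_single (M.actG b x)]
      · have hk := (key b _ rfl).2 rfl
        have hc := congrArg (Units.val) (c.compat (s * b⁻¹) b x y)
        simp only [inv_mul_cancel_right, Units.val_mul, hk] at hc
        rw [if_pos hk, if_pos rfl, TensorProduct.smul_tmul_smul, smul_smul, smul_smul, hc,
          M.actF_mul, mul_comm]
      · intro d _ hd
        rw [if_neg (Ne.symm hd), TensorProduct.tmul_zero, smul_zero]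
      · simp
    · rw [if_neg h, map_zero]
      refine (Finset.sum_eq_zero fun b _ => Finset.sum_eq_zero fun d _ => ?_).symm
      by_cases hd : M.actG b x = d
      · rw [if_neg (fun h' => h ((key b d hd).1 h')), TensorProduct.zero_tmul, smul_zero]
      · rw [if_neg hd, TensorProduct.tmul_zero, smul_zero]

/-- The inclusion `i : k^G → k^G #_{σ,τ} kF`, `e_s ↦ e_s # 1`. -/
def incl : (G → k) →ₗ[k] c.Crossed :=
  ∑ s : G, (LinearMap.proj s : (G → k) →ₗ[k] k).smulRight (c.basis (s, 1))

open scoped Classical in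
/-- The projection `π : k^G #_{σ,τ} kF → kF`, `e_s # x ↦ ε(e_s) x = δ_{s, 1} x`. -/
def proj : c.Crossed →ₗ[k] MonoidAlgebra k F :=
  c.basis.constr k fun p => if p.1 = 1 then MonoidAlgebra.single p.2 1 else 0

/-- Equivalence of the extensions `k^G → k^G #_{σ,τ} kF → kF` and `k^G → k^G #_{σ',τ'} kF → kF`:
there is a homomorphism of Hopf algebras, i.e. of bialgebras, between the middle terms that is
compatible with the maps from `k^G` and to `kF`. -/
def Equivalent (c d : M.Cocycle k) : Prop :=
  ∃ f : c.Crossed →ₐc[k] d.Crossed, (∀ a, f (c.incl a) = d.incl a) ∧ ∀ a, d.proj (f a) = c.proj a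

open scoped Classical in
lemma incl_single (s : G) : c.incl (Pi.single s 1) = c.basis (s, 1) := by
  rw [incl, LinearMap.sum_apply, Finset.sum_eq_single s]
  · simp
  · intro t _ ht
    simp [ht]
  · simp

open scoped Classical in
lemma proj_basis (p : G × F) :
    c.proj (c.basis p) = if p.1 = 1 then MonoidAlgebra.single p.2 1 else 0 := by
  rw [proj, Module.Basis.constr_basis]

/-- The projection of `k^G #_{σ,τ} kF` onto the span of the `e_s # x` with `x` fixed. -/
def homog (x : F) : c.Crossed →ₗ[k] c.Crossed :=
  (TensorProduct.rid k c.Crossed).toLinearMap ∘ₗ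
    LinearMap.lTensor c.Crossed
      (Finsupp.lapply x ∘ₗ (MonoidAlgebra.coeffLinearEquiv k).toLinearMap ∘ₗ c.proj) ∘ₗ
    Coalgebra.comul

open scoped Classical in
lemma homog_basis (x : F) (p : G × F) :
    c.homog x (c.basis p) = if p.2 = x then c.basis p else 0 := by
  simp only [homog, LinearMap.comp_apply, comul_basis, map_sum, map_smul, LinearMap.lTensor_tmul,
    proj_basis]
  rw [Finset.sum_eq_single 1]
  · obtain ⟨s, y⟩ := p
    by_cases h : y = x
    · simp [c.τ_one_right, M.one_actF, h]
    · simp [h]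
  · intro b _ hb
    simp [hb]
  · simp

variable {c}

lemma homog_comm {d : M.Cocycle k} (f : c.Crossed →ₐc[k] d.Crossed)
    (hp : ∀ a, d.proj (f a) = c.proj a) (x : F) (a : c.Crossed) :
    d.homog x (f a) = f (c.homog x a) := by
  simp only [homog, LinearMap.comp_apply]
  rw [← CoalgHomClass.map_comp_comul_apply f a]
  induction Coalgebra.comul (R := k) a using TensorProduct.induction_on with
  | zero => simp
  | add u v hu hv =>
    simp only [map_add, hu, hv]
  | tmul u v =>
    simp [hp]

/-- A homomorphism of extensions multiplies each `e_s # x` by a scalar. -/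
lemma hom_basis {d : M.Cocycle k} (f : c.Crossed →ₐc[k] d.Crossed)
    (hi : ∀ a, f (c.incl a) = d.incl a) (hp : ∀ a, d.proj (f a) = c.proj a) (p : G × F) :
    f (c.basis p) = d.basis.coord p (f (c.basis p)) • d.basis p := by
  classical
  obtain ⟨s, x⟩ := p
  have h1 : f (c.basis (s, x)) = d.homog x (d.basis (s, 1) * f (c.basis (s, x))) := by
    rw [← incl_single, ← hi, ← map_mul, homog_comm f hp, incl_single, basis_mul_basis]
    simp [M.actG_one, c.σ_one_left, homog_basis]
  have h2 : d.homog x ∘ₗ LinearMap.mulLeft k (d.basis (s, 1)) =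
      (d.basis.coord (s, x)).smulRight (d.basis (s, x)) := by
    refine d.basis.ext fun q => ?_
    obtain ⟨t, y⟩ := q
    simp only [LinearMap.comp_apply, LinearMap.mulLeft_apply, basis_mul_basis, M.actG_one,
      LinearMap.smulRight_apply, Module.Basis.coord_apply, Module.Basis.repr_self, one_mul,
      d.σ_one_left, Units.val_one, one_smul]
    by_cases hs : s = t
    · subst hs
      by_cases hx : y = x
      · subst hx
        simp [homog_basis]
      · simp [homog_basis, hx]
    · simp [hs]
  conv_lhs => rw [h1]
  exact LinearMap.congr_fun h2 _

/-- Equivalence of extensions in terms of cocycles. -/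
lemma equivalent_iff {c d : M.Cocycle k} : Equivalent c d ↔ ∃ ν : G → F → kˣ,
    (∀ s, ν s 1 = 1) ∧ (∀ x, ν 1 x = 1) ∧
    (∀ s x y, ν s (x * y) * c.σ s x y = ν s x * ν (M.actG s x) y * d.σ s x y) ∧
    ∀ s t x, ν (s * t) x * d.τ s t x = ν s (M.actF t x) * ν t x * c.τ s t x := by
  classical
  constructor
  · rintro ⟨f, hi, hp⟩
    have hf := hom_basis f hi hp
    set n : G × F → k := fun p => d.basis.coord p (f (c.basis p)) with hn
    change ∀ p, f (c.basis p) = n p • d.basis p at hf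
    have hb : ∀ (p : G × F) (a b : k), a • d.basis p = b • d.basis p → a = b := fun p a b h =>
      smul_left_injective k (d.basis.ne_zero p) h
    have hf' : ∀ p, (f : c.Crossed →ₗ[k] d.Crossed) (c.basis p) = n p • d.basis p := hf
    have hc : ∀ p q, d.basis.coord p (d.basis q) = if q = p then 1 else 0 := fun p q => by
      rw [Module.Basis.coord_apply, Module.Basis.repr_self, Finsupp.single_apply]
    have n1 : ∀ s, n (s, 1) = 1 := fun s => by
      refine hb (s, 1) _ _ ?_
      rw [← hf, ← incl_single, hi, incl_single, one_smul]
    have nε : ∀ x, n (1, x) = 1 := fun x => by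
      have := CoalgHomClass.counit_comp_apply f (c.basis (1, x))
      rw [hf] at this
      simpa [counit_basis] using this
    have nσ : ∀ s x y, n (s, x * y) * c.σ s x y = n (s, x) * n (M.actG s x, y) * d.σ s x y := by
      intro s x y
      refine hb (s, x * y) _ _ ?_
      have h := map_mul f (c.basis (s, x)) (c.basis (M.actG s x, y))
      rw [basis_mul_basis, if_pos rfl, map_smul, hf, hf, hf, smul_mul_smul_comm, basis_mul_basis,
        if_pos rfl, smul_smul, smul_smul] at h
      rw [mul_comm, h]
    have n0 : ∀ s x, n (s, x) ≠ 0 := by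
      intro s x h0
      have h := nσ s x x⁻¹
      rw [mul_inv_cancel, n1, h0, one_mul, zero_mul, zero_mul] at h
      exact (c.σ s x x⁻¹).ne_zero h
    have nτ : ∀ s t x, n (s * t, x) * d.τ s t x = n (s, M.actF t x) * n (t, x) * c.τ s t x := by
      intro s t x
      have h := CoalgHomClass.map_comp_comul_apply f (c.basis (s * t, x))
      rw [hf, map_smul, comul_basis, comul_basis] at h
      have h' := congrArg (TensorProduct.lid k k ∘ TensorProduct.map (d.basis.coord (s, M.actF t x))
        (d.basis.coord (t, x))) h
      simp only [Function.comp_apply, map_sum, map_smul, TensorProduct.map_tmul, hf', hc,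
        TensorProduct.lid_tmul, smul_eq_mul, Prod.mk.injEq] at h'
      rw [Finset.sum_eq_single t, Finset.sum_eq_single t] at h'
      · simp only [mul_inv_cancel_right, and_self, if_true, mul_one] at h'
        rw [← h', mul_comm]
      all_goals simp +contextual
    refine ⟨fun s x => Units.mk0 _ (n0 s x), fun s => ?_, fun x => ?_, fun s x y => ?_,
      fun s t x => ?_⟩
    · ext; simp [n1]
    · ext; simp [nε]
    · ext; simpa using nσ s x y
    · ext; simpa using nτ s t x
  · rintro ⟨ν, h1, hε, hσ, hτ⟩
    let f : c.Crossed →ₗ[k] d.Crossed :=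
      c.basis.constr k fun p => (ν p.1 p.2 : k) • d.basis p
    have hf : ∀ p, f (c.basis p) = (ν p.1 p.2 : k) • d.basis p := fun p =>
      Module.Basis.constr_basis _ _ _ _
    have hmul : ∀ a b, f (a * b) = f a * f b := by
      have : (LinearMap.mul k c.Crossed).compr₂ f = (LinearMap.mul k d.Crossed).compl₁₂ f f := by
        refine c.basis.ext fun p => c.basis.ext fun q => ?_
        obtain ⟨s, x⟩ := p
        obtain ⟨t, y⟩ := q
        simp only [LinearMap.compr₂_apply, LinearMap.mul_apply', LinearMap.compl₁₂_apply,
          basis_mul_basis, hf, smul_mul_smul_comm]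
        by_cases h : M.actG s x = t
        · subst h
          have := congrArg Units.val (hσ s x y)
          simp only [Units.val_mul] at this
          rw [if_pos rfl, if_pos rfl, map_smul, hf, smul_smul, smul_smul, ← this, mul_comm]
        · rw [if_neg h, if_neg h, map_zero, smul_zero]
      exact fun a b => LinearMap.congr_fun (LinearMap.congr_fun this a) b
    have hone : f 1 = 1 := by
      simp [one_def, hf, h1]
    refine ⟨BialgHom.ofAlgHom (AlgHom.ofLinearMap f hone hmul) ?_ ?_, ?_, ?_⟩
    · refine AlgHom.toLinearMap_injective (c.basis.ext fun p => ?_)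
      change Coalgebra.counit (f (c.basis p)) = Coalgebra.counit (R := k) (c.basis p)
      rw [hf, map_smul, counit_basis, counit_basis]
      split_ifs with h
      · simp [h, hε]
      · simp
    · refine AlgHom.toLinearMap_injective (c.basis.ext fun p => ?_)
      change TensorProduct.map f f (Coalgebra.comul (c.basis p)) =
        Coalgebra.comul (R := k) (f (c.basis p))
      obtain ⟨s, x⟩ := p
      simp only [hf, comul_basis, map_smul, map_sum, TensorProduct.map_tmul, Finset.smul_sum,
        TensorProduct.smul_tmul_smul, smul_smul]
      refine Finset.sum_congr rfl fun b _ => ?_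
      have h := congrArg Units.val (hτ (s * b⁻¹) b x)
      simp only [inv_mul_cancel_right, Units.val_mul] at h
      rw [h, mul_comm]
    · intro a
      change f (c.incl a) = d.incl a
      simp [incl, hf, h1]
    · intro a
      change d.proj (f a) = c.proj a
      refine LinearMap.congr_fun (f := d.proj ∘ₗ f) (c.basis.ext fun p => ?_) a
      rw [LinearMap.comp_apply, hf, map_smul, proj_basis, proj_basis]
      split_ifs with h
      · simp [h, hε]
      · simp

variable (M k) in
/-- Equivalence of abelian extensions, as a congruence relation on the group of compatible pairs
of cocycles. -/
def equivCon : Con (M.Cocycle k) where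
  r := Equivalent
  iseqv :=
    { refl := fun c => equivalent_iff.2 ⟨fun _ _ => 1, by simp⟩
      symm := fun {c d} h => by
        obtain ⟨ν, h1, hε, hσ, hτ⟩ := equivalent_iff.1 h
        refine equivalent_iff.2 ⟨fun s x => (ν s x)⁻¹, by simp [h1], by simp [hε], ?_, ?_⟩
        · intro s x y
          rw [inv_mul_eq_iff_eq_mul, ← mul_inv, mul_left_comm, hσ, inv_mul_cancel_left]
        · intro s t x
          rw [inv_mul_eq_iff_eq_mul, ← mul_inv, mul_left_comm, hτ, inv_mul_cancel_left]
      trans := fun {c d e} h h' => by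
        obtain ⟨ν, h1, hε, hσ, hτ⟩ := equivalent_iff.1 h
        obtain ⟨μ, k1, kε, kσ, kτ⟩ := equivalent_iff.1 h'
        refine equivalent_iff.2 ⟨fun s x => ν s x * μ s x, by simp [h1, k1], by simp [hε, kε],
          ?_, ?_⟩
        · intro s x y
          rw [mul_right_comm, hσ, mul_assoc, mul_comm (d.σ s x y), kσ]
          beta_reduce
          ac_rfl
        · intro s t x
          rw [mul_assoc, kτ, mul_left_comm, hτ]
          beta_reduce
          ac_rfl }
  mul' := fun {c d c' d'} h h' => by
    obtain ⟨ν, h1, hε, hσ, hτ⟩ := equivalent_iff.1 h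
    obtain ⟨μ, k1, kε, kσ, kτ⟩ := equivalent_iff.1 h'
    refine equivalent_iff.2 ⟨fun s x => ν s x * μ s x, by simp [h1, k1], by simp [hε, kε], ?_, ?_⟩
    · intro s x y
      rw [mul_σ, mul_σ, mul_mul_mul_comm, hσ, kσ]
      beta_reduce
      ac_rfl
    · intro s t x
      rw [mul_τ, mul_τ, mul_mul_mul_comm, hτ, kτ]
      beta_reduce
      ac_rfl

end Cocycle

/-- The group `Opext(kF, k^G)` of equivalence classes of abelian extensions
`k^G → k^G #_{σ,τ} kF → kF` associated to the matched pair. The Baer product of the extensions given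
by `(σ, τ)` and `(σ', τ')` is the extension given by `(σσ', ττ')`. -/
abbrev Opext [Fintype G] : Type u := (Cocycle.equivCon M k).Quotient

/-! ### The maps of the Kac exact sequence -/

open GroupExt

instance : Nonempty M.X := ⟨.ofF 1⟩

/-- The group `k^×`, written additively, as a trivial `Γ`-module. -/
abbrev unitsRep (Γ : Type u) [Group Γ] : Rep.{u} ℤ Γ := Rep.trivial ℤ Γ (Additive kˣ)

/-- The map `H^n(Σ, k^×) → H^n(F, k^×) ⊕ H^n(G, k^×)` given by restriction to `F` and to `G`. -/
def res (n : ℕ) :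
    H (unitsRep k M.Bowtie) n →+ H (unitsRep k F) n × H (unitsRep k G) n :=
  (resH (Bowtie.inclF M) (Additive kˣ) n).prod (resH (Bowtie.inclG M) (Additive kˣ) n)

/-- The Shapiro map `Ext^n_Σ(ℤ[X], k^×) → H^n(F, k^×) ⊕ H^n(G, k^×)`: restriction to `F` and to `G`
followed by evaluation at the points `1 ∈ G ⊆ X` and `1 ∈ F ⊆ X`, which represent the two orbits of
`X` and have stabilizers `F` and `G`. -/
def shapiro (n : ℕ) :
    Ext.{u} (ZX M.Bowtie M.X) (unitsRep k M.Bowtie) n →+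
      H (unitsRep k F) n × H (unitsRep k G) n :=
  (resPullback (Bowtie.inclF M) (Additive kˣ)
      (pointMap (Bowtie.inclF M) (X.ofG 1) M.inclF_smul) n).prod
    (resPullback (Bowtie.inclG M) (Additive kˣ)
      (pointMap (Bowtie.inclG M) (X.ofF 1) M.inclG_smul) n)

end MatchedPair

end

/-! The long exact `Ext`-sequence of `0 → Λ_X → ℤ[X] → ℤ → 0` becomes the Kac sequence once three
things are known.

Shapiro (`shapiro_bijective`). `X` has two orbits: that of `1 ∈ G`, with stabilizer `F`, and that of
`1 ∈ F`, with stabilizer `G`. So `Hom(ℤ[X], W)` is `W^F × W^G`, which makes `ℤ[X]` the sum of two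
induced trivial modules. Induction is exact and left adjoint to restriction, so the isomorphism
passes to all `Ext^n`. Since the augmentation sends each point to `1`, the map induced by the
augmentation turns into restriction.

The left end (`exists_kernel_ι_comp_eq`). `Σ` acts simply transitively on `F × G`, so `Λ_X` is
generated by the translates of `1_F - 1_G`. A map from `Λ_X` to a trivial module is thus given by
one value and extends to `ℤ[X]`. The first connecting map is therefore zero and `res 1` is
injective.

`Opext` (`nonempty_opext_addEquiv_ext`). The modules `C(p, q) = ℤ[F^p × G^q]` form a double complex
with contractible rows and columns. Its part with `p, q ≥ 2`, spliced by `dA ∘ dB : C(2, 2) → C(1,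
1)` and by `(a, b) ↦ a - b`, resolves `Λ_X`: `C(4,2) ⊕ C(3,3) ⊕ C(2,4) → C(3,2) ⊕ C(2,3) → C(2,2) →
C(1,1) → Λ_X → 0`. By simple transitivity a cochain with trivial coefficients is a function on
tuples that start with `1`. In degree one this is a function `ν` on `G × F`, and in degree two a
pair `(σ, τ)`. The three summands in degree three give the cocycle identity of `σ`, the
compatibility, and the cocycle identity of `τ`. The coboundary of `ν` is the change of `(σ, τ)`
under an equivalence of extensions, since such an equivalence multiplies `e_s # x` by `ν(s, x)`. As
every class contains a normalized cocycle, `Ext²(Λ_X, k^×)` is `Opext`. -/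

noncomputable section

/-! ### Ext groups and adjunctions -/

namespace ExtAdjunction

open Limits

universe w w' v v' u₁ u₂

variable {C : Type u₁} [Category.{v} C] [Abelian C] [HasExt.{w} C]
  {D : Type u₂} [Category.{v'} D] [Abelian D] [HasExt.{w'} D]
  {L : D ⥤ C} {R : C ⥤ D} [R.Additive] [PreservesFiniteLimits R] [PreservesFiniteColimits R]

/-- For an exact functor `R` and `b : X ⟶ R B`, the map `Ext^n(B, Y) → Ext^n(X, R Y)` that applies
`R` and pulls back along `b`. -/
def unitPullback (R : C ⥤ D) [R.Additive] [PreservesFiniteLimits R] [PreservesFiniteColimits R]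
    {X : D} {B : C} (b : X ⟶ R.obj B) (Y : C) (n : ℕ) : Ext.{w} B Y n →+ Ext.{w'} X (R.obj Y) n :=
  ((Ext.mk₀ b).precomp (R.obj Y) (zero_add n)).comp (R.mapExtAddHom B Y n)

lemma unitPullback_apply {X : D} {B : C} (b : X ⟶ R.obj B) (Y : C) (n : ℕ) (e : Ext.{w} B Y n) :
    unitPullback R b Y n e = (Ext.mk₀ b).comp (e.mapExactFunctor R) (zero_add n) := rfl

lemma unitPullback_mk₀_comp {X : D} {B B' : C} (b : X ⟶ R.obj B) (g : B ⟶ B') (Y : C) (n : ℕ)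
    (e : Ext.{w} B' Y n) :
    unitPullback R b Y n ((Ext.mk₀ g).comp e (zero_add n)) =
      unitPullback R (b ≫ R.map g) Y n e := by
  simp [unitPullback_apply, Ext.mapExactFunctor_comp, Ext.mapExactFunctor_mk₀]

/-- An exact functor carries the extension class of `T` to that of `R T`, and extension classes are
natural along `φ`. This is the commuting square needed for dimension shifting on both sides of an
adjunction. -/
lemma extClass_comp_unitPullback {S : ShortComplex D} {T : ShortComplex C} (hS : S.ShortExact)
    (hT : T.ShortExact) (φ : S ⟶ T.map R) (Y : C) (n : ℕ) (e : Ext.{w} T.X₁ Y n) :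
    hS.extClass.comp (unitPullback R φ.τ₁ Y n e) (add_comm 1 n) =
      unitPullback R φ.τ₃ Y (n + 1) (hT.extClass.comp e (add_comm 1 n)) := by
  let e' : Ext.{w'} (T.map R).X₁ (R.obj Y) n := e.mapExactFunctor R
  have h : (hT.extClass.comp e (add_comm 1 n)).mapExactFunctor R =
      (hT.map_of_exact R).extClass.comp e' (add_comm 1 n) := by
    rw [Ext.mapExactFunctor_comp, Ext.mapExactFunctor_extClass]
    rfl
  calc
    _ = hS.extClass.comp ((Ext.mk₀ φ.τ₁).comp e' (zero_add n)) (add_comm 1 n) := rfl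
    _ = (Ext.mk₀ φ.τ₃).comp ((hT.map_of_exact R).extClass.comp e' (add_comm 1 n))
        (zero_add (n + 1)) := by
      rw [← Ext.comp_assoc_of_second_deg_zero,
        ShortComplex.ShortExact.extClass_naturality hS (hT.map_of_exact R) φ]
      exact Ext.comp_assoc _ _ _ (zero_add 1) (add_comm 1 n) (by lia)
    _ = _ := congrArg (fun t => (Ext.mk₀ φ.τ₃).comp t (zero_add (n + 1))) h.symm

attribute [local instance] Ext.subsingleton_of_projective in
/-- If an exact functor `R` has a left adjoint `L` that preserves monomorphisms, then
`Ext^n(L X, Y) ≅ Ext^n(X, R Y)`. -/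
theorem unitPullback_bijective [EnoughProjectives D] [L.Additive] [L.PreservesMonomorphisms]
    (adj : L ⊣ R) (X : D) (Y : C) (n : ℕ) :
    Function.Bijective (unitPullback R (adj.unit.app X) Y n) := by
  induction n generalizing X with
  | zero =>
    have h : ∀ f : L.obj X ⟶ Y, unitPullback R (adj.unit.app X) Y 0 (Ext.mk₀ f) =
        Ext.mk₀ (adj.homEquiv X Y f) := fun f => by
      rw [unitPullback_apply, Ext.mapExactFunctor_mk₀, Ext.mk₀_comp_mk₀, Adjunction.homEquiv_unit]
    have h' : unitPullback R (adj.unit.app X) Y 0 ∘ Ext.mk₀ = Ext.mk₀ ∘ adj.homEquiv X Y :=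
      funext h
    refine (Function.Bijective.of_comp_iff _ (Ext.mk₀_bijective _ _)).1 ?_
    rw [h']
    exact (Ext.mk₀_bijective _ _).comp (adj.homEquiv X Y).bijective
  | succ n hn =>
    -- A left adjoint is right exact; together with preservation of monomorphisms this makes `L`
    -- exact.
    have : PreservesColimitsOfSize.{0, 0} L := adj.leftAdjoint_preservesColimits
    have : L.PreservesHomology := L.preservesHomology_of_preservesMonos_and_cokernels
    let P : ProjectivePresentation X := Classical.arbitrary _
    let S := ShortComplex.mk _ _ (kernel.condition P.f)
    have hS : S.ShortExact := { exact := ShortComplex.exact_kernel P.f }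
    have : Mono S.f := hS.mono_f
    have : Epi S.g := hS.epi_g
    have : Projective S.X₂ := P.projective
    have : R.PreservesEpimorphisms := inferInstance
    -- `L` preserves projectives because its right adjoint `R` preserves epimorphisms. Hence both
    -- rows below end in a vanishing `Ext^{n+1}` of a projective object.
    have hP : Projective (S.map L).X₂ := adj.map_projective _ P.projective
    have hL : (S.map L).ShortExact := hS.map L
    let φ : S ⟶ (S.map L).map R :=
      { τ₁ := adj.unit.app _
        τ₂ := adj.unit.app _
        τ₃ := adj.unit.app _
        comm₁₂ := (adj.unit.naturality _).symm
        comm₂₃ := (adj.unit.naturality _).symm }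
    -- The five lemma for `Ext^n(S.X₂) → Ext^n(S.X₁) → Ext^{n+1}(S.X₃) → 0`, compared with the same
    -- row for `L S`; the two left vertical maps are covered by the induction hypothesis.
    refine AddMonoidHom.bijective_of_surjective_of_bijective_of_right_exact _ _ _ _
      (unitPullback R (adj.unit.app S.X₂) Y n) (unitPullback R (adj.unit.app S.X₁) Y n)
      (unitPullback R (adj.unit.app S.X₃) Y (n + 1)) ?_ ?_
      ((ShortComplex.ab_exact_iff_function_exact _).1
        (Ext.contravariant_sequence_exact₁' hL Y n (n + 1) (add_comm 1 n)))
      ((ShortComplex.ab_exact_iff_function_exact _).1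
        (Ext.contravariant_sequence_exact₁' hS (R.obj Y) n (n + 1) (add_comm 1 n)))
      (hn _).surjective (hn _)
      (fun x₃ ↦ Ext.contravariant_sequence_exact₃ hL _ x₃ (by subsingleton) (add_comm 1 n))
      (fun y₃ ↦ Ext.contravariant_sequence_exact₃ hS _ y₃ (by subsingleton) (add_comm 1 n))
    · ext e
      change (Ext.mk₀ S.f).comp ((Ext.mk₀ (adj.unit.app S.X₂)).comp (e.mapExactFunctor R)
          (zero_add n)) (zero_add n) =
        unitPullback R (adj.unit.app S.X₁) Y n ((Ext.mk₀ (L.map S.f)).comp e (zero_add n))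
      rw [unitPullback_mk₀_comp, unitPullback_apply, Ext.mk₀_comp_mk₀_assoc]
      exact congrArg (fun t => (Ext.mk₀ t).comp (e.mapExactFunctor R) (zero_add n)) φ.comm₁₂.symm
    · ext e
      exact extClass_comp_unitPullback hS hL φ Y n e

end ExtAdjunction

/-! ### Ext groups in degree two -/

namespace ExtTwo

open Limits

universe w v u₁

variable {C : Type u₁} [Category.{v} C] [Abelian C]

/-- The cocycles `f : P₂ ⟶ V` with respect to `d : P₃ ⟶ P₂`. -/
def cocycles {P₃ P₂ : C} (d : P₃ ⟶ P₂) (V : C) : AddSubgroup (P₂ ⟶ V) :=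
  (Preadditive.leftComp V d).ker

lemma mem_cocycles {P₃ P₂ : C} {d : P₃ ⟶ P₂} {V : C} (f : P₂ ⟶ V) :
    f ∈ cocycles d V ↔ d ≫ f = 0 := Iff.rfl

variable [HasExt.{w} C]

-- Dimension shifting: both neighbours are positive `Ext` groups of the projective object `S.X₂`.
-- The source has degree `n + 1` because `Ext⁰(S.X₂, V)` need not vanish.
attribute [local instance] Ext.subsingleton_of_projective in
lemma extClass_comp_bijective {S : ShortComplex C} (hS : S.ShortExact) [Projective S.X₂] (V : C)
    (n : ℕ) : Function.Bijective (hS.extClass.precomp V (add_comm 1 (n + 1))) := by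
  constructor
  · refine (injective_iff_map_eq_zero _).2 fun e he => ?_
    obtain ⟨e', rfl⟩ := Ext.contravariant_sequence_exact₁ hS V e (add_comm 1 (n + 1)) he
    rw [Subsingleton.elim e' 0, Ext.comp_zero]
  · exact fun e => Ext.contravariant_sequence_exact₃ hS V e (Subsingleton.elim _ _)
      (add_comm 1 (n + 1))

attribute [local instance] Ext.subsingleton_of_projective in
lemma extClass_comp_mk₀_surjective {S : ShortComplex C} (hS : S.ShortExact) [Projective S.X₂]
    (V : C) (e : Ext.{w} S.X₃ V 1) :
    ∃ f : S.X₁ ⟶ V, hS.extClass.comp (Ext.mk₀ f) (add_zero 1) = e := by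
  obtain ⟨x, hx⟩ := Ext.contravariant_sequence_exact₃ hS V e (Subsingleton.elim _ _) (add_zero 1)
  obtain ⟨f, rfl⟩ := (Ext.mk₀_bijective _ _).2 x
  exact ⟨f, hx⟩

/-- Exactness of the `Ext`-sequence in its lowest degree. It yields the coboundaries of
`exists_cocycles_surjective` and the vanishing of the first connecting map of the Kac sequence. -/
lemma extClass_comp_mk₀_eq_zero_iff {S : ShortComplex C} (hS : S.ShortExact) {V : C}
    (f : S.X₁ ⟶ V) :
    hS.extClass.comp (Ext.mk₀ f) (add_zero 1) = 0 ↔ ∃ g : S.X₂ ⟶ V, S.f ≫ g = f := by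
  constructor
  · intro h
    obtain ⟨x, hx⟩ := Ext.contravariant_sequence_exact₁ hS V (Ext.mk₀ f) (add_zero 1) h
    obtain ⟨g, rfl⟩ := (Ext.mk₀_bijective _ _).2 x
    rw [Ext.mk₀_comp_mk₀] at hx
    exact ⟨g, (Ext.mk₀_bijective _ _).1 hx⟩
  · rintro ⟨g, rfl⟩
    rw [← Ext.mk₀_comp_mk₀, ShortComplex.ShortExact.extClass_comp_assoc]

/-- `Ext²(A, V)` is the second cohomology of `Hom(P, V)`, where `P₃ → P₂ → P₁ → P₀ → A → 0` is
exact and `P₀`, `P₁` are projective. -/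
theorem exists_cocycles_surjective {P₃ P₂ P₁ P₀ A : C} {d₃ : P₃ ⟶ P₂} {d₂ : P₂ ⟶ P₁} {d₁ : P₁ ⟶ P₀}
    {d₀ : P₀ ⟶ A} (w₂ : d₃ ≫ d₂ = 0) (w₁ : d₂ ≫ d₁ = 0) (w₀ : d₁ ≫ d₀ = 0)
    (h₂ : (ShortComplex.mk d₃ d₂ w₂).Exact) (h₁ : (ShortComplex.mk d₂ d₁ w₁).Exact)
    (h₀ : (ShortComplex.mk d₁ d₀ w₀).Exact) [Epi d₀] [Projective P₀] [Projective P₁] (V : C) :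
    ∃ Θ : cocycles d₃ V →+ Ext.{w} A V 2, Function.Surjective Θ ∧
      ∀ f, Θ f = 0 ↔ ∃ g : P₁ ⟶ V, d₂ ≫ g = f := by
  let S₀ := ShortComplex.mk (kernel.ι d₀) d₀ (kernel.condition d₀)
  have hS₀ : S₀.ShortExact := { exact := ShortComplex.exact_kernel d₀ }
  let p₁ : P₁ ⟶ kernel d₀ := kernel.lift d₀ d₁ w₀
  have : Epi p₁ := h₀.epi_kernelLift
  let S₁ := ShortComplex.mk (kernel.ι p₁) p₁ (kernel.condition p₁)
  have hS₁ : S₁.ShortExact := { exact := ShortComplex.exact_kernel p₁ }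
  have hp₁ : p₁ ≫ kernel.ι d₀ = d₁ := kernel.lift_ι _ _ _
  have w₁' : d₂ ≫ p₁ = 0 := by
    rw [← cancel_mono (kernel.ι d₀), Category.assoc, hp₁, w₁, zero_comp]
  have h₁' : (ShortComplex.mk d₂ p₁ w₁').Exact := by
    refine (ShortComplex.exact_iff_of_epi_of_isIso_of_mono (S₁ := ShortComplex.mk d₂ p₁ w₁')
      (S₂ := ShortComplex.mk d₂ d₁ w₁)
      { τ₁ := 𝟙 _, τ₂ := 𝟙 _, τ₃ := kernel.ι d₀ }).2 h₁
  let p₂ : P₂ ⟶ kernel p₁ := kernel.lift p₁ d₂ w₁'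
  have : Epi p₂ := h₁'.epi_kernelLift
  have hp₂ : p₂ ≫ kernel.ι p₁ = d₂ := kernel.lift_ι _ _ _
  have w₂' : d₃ ≫ p₂ = 0 := by
    rw [← cancel_mono (kernel.ι p₁), Category.assoc, hp₂, w₂, zero_comp]
  have h₂' : (ShortComplex.mk d₃ p₂ w₂').Exact := by
    refine (ShortComplex.exact_iff_of_epi_of_isIso_of_mono (S₁ := ShortComplex.mk d₃ p₂ w₂')
      (S₂ := ShortComplex.mk d₃ d₂ w₂)
      { τ₁ := 𝟙 _, τ₂ := 𝟙 _, τ₃ := kernel.ι p₁ }).2 h₂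
  -- By exactness `kernel p₁` is the cokernel of `d₃`, so a cocycle is the same as a map `kernel p₁
  -- ⟶ V`.
  let r : cocycles d₃ V →+ (kernel p₁ ⟶ V) := AddMonoidHom.mk'
    (fun f => h₂'.desc f.1 f.2) fun f g => by
      rw [← cancel_epi p₂, Preadditive.comp_add]
      exact (h₂'.g_desc _ _).trans (congrArg₂ (· + ·) (h₂'.g_desc f.1 f.2) (h₂'.g_desc g.1 g.2)).symm
  have hr : ∀ f, p₂ ≫ r f = f := fun f => h₂'.g_desc f.1 f.2
  -- Two connecting maps `Hom(kernel p₁, V) → Ext¹(kernel d₀, V) → Ext²(A, V)`. The second is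
  -- bijective, so the kernel of `Θ` comes from the first and consists of the maps that extend to
  -- `P₁`.
  refine ⟨(hS₀.extClass.precomp V (add_comm 1 1)).comp
    ((hS₁.extClass.precomp V (add_zero 1)).comp (Ext.addEquiv₀.symm.toAddMonoidHom.comp r)),
    ?_, fun f => ?_⟩
  · intro e
    obtain ⟨e₁, rfl⟩ := (extClass_comp_bijective hS₀ V 0).2 e
    obtain ⟨g, rfl⟩ := extClass_comp_mk₀_surjective hS₁ V e₁
    refine ⟨⟨p₂ ≫ g, ?_⟩, ?_⟩
    · rw [mem_cocycles, reassoc_of% w₂', zero_comp]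
    · have : r ⟨p₂ ≫ g, by rw [mem_cocycles, reassoc_of% w₂', zero_comp]⟩ = g := by
        rw [← cancel_epi p₂, hr]
      change hS₀.extClass.comp (hS₁.extClass.comp (Ext.mk₀ (r _)) (add_zero 1)) (add_comm 1 1) = _
      rw [this]
      rfl
  · change hS₀.extClass.precomp V (add_comm 1 1) _ = 0 ↔ _
    rw [map_eq_zero_iff _ (extClass_comp_bijective hS₀ V 0).1]
    refine (extClass_comp_mk₀_eq_zero_iff hS₁ (r f)).trans (exists_congr fun g => ?_)
    rw [← hr f, ← hp₂, Category.assoc, cancel_epi]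

end ExtTwo

end

noncomputable section

/-! ### Permutation modules -/

namespace PermRep

variable {R : Type} [CommRing R]

section linearLift

variable {Y W : Type*} [AddCommGroup W] [Module R W]

/-- The linear map `R[Y] → W` with values `w` on the basis `Y`. -/
def linearLift (w : Y → W) : MonoidAlgebra R Y →ₗ[R] W :=
  Finsupp.linearCombination R w ∘ₗ (MonoidAlgebra.coeffLinearEquiv R).toLinearMap

@[simp]
lemma linearLift_single (w : Y → W) (y : Y) :
    linearLift w (MonoidAlgebra.single y (1 : R)) = w y := by
  change Finsupp.linearCombination R w (MonoidAlgebra.single y (1 : R)).coeff = _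
  rw [MonoidAlgebra.coeff_single, Finsupp.linearCombination_single, one_smul]

lemma linearMap_ext {f g : MonoidAlgebra R Y →ₗ[R] W}
    (h : ∀ y, f (MonoidAlgebra.single y 1) = g (MonoidAlgebra.single y 1)) : f = g :=
  MonoidAlgebra.lhom_ext' fun y => LinearMap.ext_ring (h y)

end linearLift

variable {Γ : Type u} [Group Γ] {Y : Type u} [MulAction Γ Y]

/-- The value of a homomorphism `f : R[Y] → W` at `y ∈ Y`. -/
def value {W : Rep.{u} R Γ} (f : Rep.ofMulAction R Γ Y ⟶ W) (y : Y) : W :=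
  f.hom (MonoidAlgebra.single y 1)

lemma value_smul {W : Rep.{u} R Γ} (f : Rep.ofMulAction R Γ Y ⟶ W) (g : Γ) (y : Y) :
    value f (g • y) = W.ρ g (value f y) := by
  rw [value, value, ← Rep.hom_comm_apply]
  simp

lemma value_comp {W W' : Rep.{u} R Γ} (f : Rep.ofMulAction R Γ Y ⟶ W) (h : W ⟶ W') (y : Y) :
    value (f ≫ h) y = h.hom (value f y) := rfl

lemma value_zero {W : Rep.{u} R Γ} (y : Y) :
    value (0 : Rep.ofMulAction R Γ Y ⟶ W) y = 0 := rfl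

lemma hom_ext {W : Rep.{u} R Γ} {f g : Rep.ofMulAction R Γ Y ⟶ W}
    (h : ∀ y, value f y = value g y) : f = g :=
  Rep.hom_ext (Representation.IntertwiningMap.ext (linearMap_ext h))

/-- The homomorphism `R[Y] → W` with values `w` on the basis `Y`. -/
def lift {W : Rep.{u} R Γ} (w : Y → W) (hw : ∀ g y, w (g • y) = W.ρ g (w y)) :
    Rep.ofMulAction R Γ Y ⟶ W :=
  Rep.ofHom (σ := W.ρ)
    { toLinearMap := linearLift w
      isIntertwining' := fun g => linearMap_ext fun y => by simp [hw] }

@[simp]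
lemma value_lift {W : Rep.{u} R Γ} (w : Y → W) (hw : ∀ g y, w (g • y) = W.ρ g (w y)) (y : Y) :
    value (lift w hw) y = w y :=
  linearLift_single w y

/-- The module `R[Y]` is projective if `Γ` acts freely on `Y`, as witnessed by an equivariant map
`γ : Y → Γ`. -/
lemma projective (γ : Y → Γ) (hγ : ∀ g y, γ (g • y) = g * γ y) :
    Projective (Rep.ofMulAction R Γ Y) where
  factors {E B} f e he := by
    have hs := (Rep.epi_iff_surjective e).1 he
    choose s hs using hs
    -- The set-theoretic lift `s` is used only at the representative `(γ y)⁻¹ • y` of the orbit of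
    -- `y` and is then translated back, which makes it equivariant.
    refine ⟨lift (fun y => E.ρ (γ y) (s (value f ((γ y)⁻¹ • y)))) ?_, ?_⟩
    · intro g y
      rw [hγ, mul_inv_rev, mul_smul, inv_smul_smul, map_mul, Module.End.mul_apply]
    · refine hom_ext fun y => ?_
      rw [value_comp, value_lift, Rep.hom_comm_apply, hs, ← value_smul, smul_inv_smul]

lemma exact_iff (S : ShortComplex (Rep.{u} R Γ)) :
    S.Exact ↔ ∀ z, S.g.hom z = 0 → ∃ y, S.f.hom y = z := by
  rw [← ShortComplex.exact_map_iff_of_faithful S (forget₂ (Rep.{u} R Γ) (ModuleCat.{u} R)),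
    ShortComplex.moduleCat_exact_iff]
  rfl

/-! ### Induction along an injective homomorphism -/

variable {Δ : Type u} [Group Δ] (f : Δ →* Γ)

/-- The map `γ` selects the representative `f (γ g)⁻¹ * g` in each coset of the image of `Δ`. Moving
tensors to these representatives embeds the induced module into `Γ →₀ A`, naturally in `A`, and on
finitely supported functions a monomorphism clearly acts injectively. -/
lemma indFunctor_preservesMonomorphisms (γ : Γ → Δ) (hγ : ∀ d g, γ (f d * g) = d * γ g) :
    (Rep.indFunctor.{u} R f).PreservesMonomorphisms where
  preserves {A B} i hi := by
    -- `T` writes the class of `g ⊗ a` at the chosen representative of its coset; equivariance of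
    -- `γ` makes this well defined on coinvariants.
    let T (A : Rep.{u} R Δ) : Representation.IndV f A.ρ →ₗ[R] (Γ →₀ A) :=
      Representation.Coinvariants.lift _
        (TensorProduct.lift (linearLift fun g =>
          Finsupp.lsingle (f (γ g)⁻¹ * g) ∘ₗ A.ρ (γ g)⁻¹)) fun d => by
            ext g a : 4
            simp [hγ]
    have hT (A : Rep.{u} R Δ) (g : Γ) (a : A) : T A (Representation.IndV.mk f A.ρ g a) =
        Finsupp.single (f (γ g)⁻¹ * g) (A.ρ (γ g)⁻¹ a) := by
      simp [T]
    let S (A : Rep.{u} R Δ) : (Γ →₀ A) →ₗ[R] Representation.IndV f A.ρ :=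
      Finsupp.lsum R fun g => Representation.IndV.mk f A.ρ g
    have hST (A : Rep.{u} R Δ) : S A ∘ₗ T A = LinearMap.id := by
      refine Representation.IndV.hom_ext _ _ fun g => LinearMap.ext fun a => ?_
      rw [LinearMap.comp_apply, LinearMap.comp_apply, hT]
      simp only [S, Finsupp.lsum_single]
      -- In the coinvariants `g ⊗ a` equals its translate by `(γ g)⁻¹`, which is `S (T (g ⊗ a))`.
      refine Eq.trans ?_ (Representation.Coinvariants.mk_self_apply
        (Representation.tprod ((Representation.leftRegular R Γ).comp f) A.ρ) (γ g)⁻¹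
        (MonoidAlgebra.single g 1 ⊗ₜ[R] a))
      simp
    rw [Rep.mono_iff_injective] at hi ⊢
    have hc : T B ∘ₗ (Rep.indMap f i).hom.toLinearMap =
        Finsupp.mapRange.linearMap i.hom.toLinearMap ∘ₗ T A := by
      refine Representation.IndV.hom_ext _ _ fun g => LinearMap.ext fun a => ?_
      have : (Rep.indMap f i).hom.toLinearMap (Representation.IndV.mk f A.ρ g a) =
        Representation.IndV.mk f B.ρ g (i.hom a) := by simp [Rep.indMap]
      refine (congrArg (T B) this).trans ((hT B g (i.hom a)).trans ?_)
      refine Eq.trans ?_ (congrArg (Finsupp.mapRange.linearMap i.hom.toLinearMap) (hT A g a)).symm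
      rw [Finsupp.mapRange.linearMap_apply, Finsupp.mapRange_single]
      exact congrArg _ (Rep.hom_comm_apply i _ a).symm
    have hinj : Function.Injective (T A) :=
      Function.LeftInverse.injective (g := S A) fun z => LinearMap.congr_fun (hST A) z
    exact fun a b hab => hinj (Finsupp.mapRange_injective i.hom (map_zero _) hi
      ((LinearMap.congr_fun hc a).symm.trans
        ((congrArg (T B) hab).trans (LinearMap.congr_fun hc b))))

end PermRep

end

noncomputable section

/-! ### Faces of products of simplices -/

namespace PermRep

section faces

variable {R : Type} [CommRing R] {A B : Type u}

/-- Pairs of a `p`-tuple in `A` and a `q`-tuple in `B`. -/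
abbrev Tuples (A B : Type u) (p q : ℕ) : Type u := (Fin p → A) × (Fin q → B)

variable (R A B) in
/-- The free module on the pairs of a `p`-tuple in `A` and a `q`-tuple in `B`. -/
abbrev Chains (p q : ℕ) : Type u := MonoidAlgebra R (Tuples A B p q)

/-- The basis element of a pair of tuples. -/
abbrev pt {p q : ℕ} (a : Fin p → A) (b : Fin q → B) : Chains R A B p q :=
  MonoidAlgebra.single (a, b) 1

/-- The alternating sum of the faces in the direction of `A`. -/
def dA {p q : ℕ} : Chains R A B (p + 1) q →ₗ[R] Chains R A B p q :=
  linearLift fun y => ∑ i : Fin (p + 1), (-1 : R) ^ (i : ℕ) • pt (y.1 ∘ i.succAbove) y.2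

/-- The alternating sum of the faces in the direction of `B`. -/
def dB {p q : ℕ} : Chains R A B p (q + 1) →ₗ[R] Chains R A B p q :=
  linearLift fun y => ∑ i : Fin (q + 1), (-1 : R) ^ (i : ℕ) • pt y.1 (y.2 ∘ i.succAbove)

/-- Insertion of a point of `A`. -/
def hA (a₀ : A) {p q : ℕ} : Chains R A B p q →ₗ[R] Chains R A B (p + 1) q :=
  linearLift fun y => pt (Fin.cons a₀ y.1) y.2

/-- Insertion of a point of `B`. -/
def hB (b₀ : B) {p q : ℕ} : Chains R A B p q →ₗ[R] Chains R A B p (q + 1) :=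
  linearLift fun y => pt y.1 (Fin.cons b₀ y.2)

variable {p q : ℕ} (a₀ : A) (b₀ : B)

lemma dA_pt (a : Fin (p + 1) → A) (b : Fin q → B) :
    dA (pt (R := R) a b) = ∑ i : Fin (p + 1), (-1 : R) ^ (i : ℕ) • pt (a ∘ i.succAbove) b :=
  linearLift_single _ _

lemma dB_pt (a : Fin p → A) (b : Fin (q + 1) → B) :
    dB (pt (R := R) a b) = ∑ i : Fin (q + 1), (-1 : R) ^ (i : ℕ) • pt a (b ∘ i.succAbove) :=
  linearLift_single _ _

lemma hA_pt (a : Fin p → A) (b : Fin q → B) : hA a₀ (pt (R := R) a b) = pt (Fin.cons a₀ a) b :=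
  linearLift_single _ _

lemma hB_pt (a : Fin p → A) (b : Fin q → B) : hB b₀ (pt (R := R) a b) = pt a (Fin.cons b₀ b) :=
  linearLift_single _ _

lemma cons_comp_succAbove_succ {X : Type*} {n : ℕ} (x : X) (a : Fin (n + 1) → X) (i : Fin (n + 1)) :
    (Fin.cons x a : Fin (n + 2) → X) ∘ i.succ.succAbove = Fin.cons x (a ∘ i.succAbove) := by
  funext j
  refine Fin.cases ?_ (fun j => ?_) j
  · simp
  · simp [Fin.succ_succAbove_succ]

lemma cons_comp_succAbove_zero {X : Type*} {n : ℕ} (x : X) (a : Fin n → X) :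
    (Fin.cons x a : Fin (n + 1) → X) ∘ (0 : Fin (n + 1)).succAbove = a := by
  funext j
  simp

/-- The zeroth face deletes the inserted point, and the other faces are those of the old tuple with
the index, hence the sign, shifted by one. Empty tuples are allowed, so this contracts the augmented
complex of tuples. -/
lemma dA_hA (z : Chains R A B (p + 1) q) : dA (hA a₀ z) = z - hA a₀ (dA z) := by
  suffices h : dA ∘ₗ hA a₀ = LinearMap.id - hA a₀ ∘ₗ dA from LinearMap.congr_fun h z
  refine linearMap_ext fun ⟨a, b⟩ => ?_
  change dA (hA a₀ (pt a b)) = pt a b - hA a₀ (dA (pt a b))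
  rw [hA_pt, dA_pt, dA_pt, Fin.sum_univ_succ, map_sum]
  simp only [map_smul, cons_comp_succAbove_zero, cons_comp_succAbove_succ, hA_pt, Fin.val_succ,
    pow_succ, Fin.val_zero, pow_zero, one_smul, mul_neg, mul_one, neg_smul, Finset.sum_neg_distrib,
    sub_eq_add_neg]

lemma dB_hB (z : Chains R A B p (q + 1)) : dB (hB b₀ z) = z - hB b₀ (dB z) := by
  suffices h : dB ∘ₗ hB b₀ = LinearMap.id - hB b₀ ∘ₗ dB from LinearMap.congr_fun h z
  refine linearMap_ext fun ⟨a, b⟩ => ?_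
  change dB (hB b₀ (pt a b)) = pt a b - hB b₀ (dB (pt a b))
  rw [hB_pt, dB_pt, dB_pt, Fin.sum_univ_succ, map_sum]
  simp only [map_smul, cons_comp_succAbove_zero, cons_comp_succAbove_succ, hB_pt, Fin.val_succ,
    pow_succ, Fin.val_zero, pow_zero, one_smul, mul_neg, mul_one, neg_smul, Finset.sum_neg_distrib,
    sub_eq_add_neg]

lemma dA_dB (z : Chains R A B (p + 1) (q + 1)) : dA (dB z) = dB (dA z) := by
  suffices h : (dA ∘ₗ dB : Chains R A B (p + 1) (q + 1) →ₗ[R] _) = dB ∘ₗ dA from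
    LinearMap.congr_fun h z
  refine linearMap_ext fun ⟨a, b⟩ => ?_
  change dA (dB (pt a b)) = dB (dA (pt a b))
  rw [dA_pt, dB_pt, map_sum, map_sum]
  simp only [map_smul, dA_pt, dB_pt, Finset.smul_sum]
  rw [Finset.sum_comm]
  exact Finset.sum_congr rfl fun i _ => Finset.sum_congr rfl fun j _ => smul_comm _ _ _

lemma dB_hA (z : Chains R A B p (q + 1)) : dB (hA a₀ z) = hA a₀ (dB z) := by
  suffices h : (dB ∘ₗ hA a₀ : Chains R A B p (q + 1) →ₗ[R] _) = hA a₀ ∘ₗ dB from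
    LinearMap.congr_fun h z
  refine linearMap_ext fun ⟨a, b⟩ => ?_
  change dB (hA a₀ (pt a b)) = hA a₀ (dB (pt a b))
  simp only [dB_pt, hA_pt, map_sum, map_smul]

/-- A basis tuple is `hA x w` with `x` its first entry. By the contraction identity `dA (dA (hA x
w)) = hA x (dA (dA w))`, so induction on the length replaces the double sum over faces. -/
lemma dA_dA (z : Chains R A B (p + 2) q) : dA (dA z) = 0 := by
  induction p with
  | zero =>
    suffices h : (dA ∘ₗ dA : Chains R A B 2 q →ₗ[R] _) = 0 from LinearMap.congr_fun h z
    refine linearMap_ext fun ⟨a, b⟩ => ?_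
    obtain ⟨x, a, rfl⟩ : ∃ x a', a = Fin.cons x a' := ⟨a 0, Fin.tail a, (Fin.cons_self_tail a).symm⟩
    change dA (dA (pt (R := R) (Fin.cons x a) b)) = 0
    rw [← hA_pt, dA_hA, map_sub]
    -- The contraction identity at the empty tuple, where the term `hA (dA z)` is absent.
    have h1 : ∀ z : Chains R A B 0 q, dA (hA x z) = z := fun z => by
      suffices h : (dA ∘ₗ hA x : Chains R A B 0 q →ₗ[R] _) = LinearMap.id from
        LinearMap.congr_fun h z
      refine linearMap_ext fun ⟨a, b⟩ => ?_
      simp [hA_pt, dA_pt]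
    rw [h1, sub_self]
  | succ p ih =>
    suffices h : (dA ∘ₗ dA : Chains R A B (p + 3) q →ₗ[R] _) = 0 from LinearMap.congr_fun h z
    refine linearMap_ext fun ⟨a, b⟩ => ?_
    obtain ⟨x, a, rfl⟩ : ∃ x a', a = Fin.cons x a' := ⟨a 0, Fin.tail a, (Fin.cons_self_tail a).symm⟩
    change dA (dA (pt (R := R) (Fin.cons x a) b)) = 0
    rw [← hA_pt, dA_hA, map_sub, dA_hA, ih, map_zero, sub_zero, sub_self]

lemma dB_dB (z : Chains R A B p (q + 2)) : dB (dB z) = 0 := by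
  induction q with
  | zero =>
    suffices h : (dB ∘ₗ dB : Chains R A B p 2 →ₗ[R] _) = 0 from LinearMap.congr_fun h z
    refine linearMap_ext fun ⟨a, b⟩ => ?_
    obtain ⟨x, b, rfl⟩ : ∃ x b', b = Fin.cons x b' := ⟨b 0, Fin.tail b, (Fin.cons_self_tail b).symm⟩
    change dB (dB (pt (R := R) a (Fin.cons x b))) = 0
    rw [← hB_pt, dB_hB, map_sub]
    have h1 : ∀ z : Chains R A B p 0, dB (hB x z) = z := fun z => by
      suffices h : (dB ∘ₗ hB x : Chains R A B p 0 →ₗ[R] _) = LinearMap.id from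
        LinearMap.congr_fun h z
      refine linearMap_ext fun ⟨a, b⟩ => ?_
      simp [hB_pt, dB_pt]
    rw [h1, sub_self]
  | succ q ih =>
    suffices h : (dB ∘ₗ dB : Chains R A B p (q + 3) →ₗ[R] _) = 0 from LinearMap.congr_fun h z
    refine linearMap_ext fun ⟨a, b⟩ => ?_
    obtain ⟨x, b, rfl⟩ : ∃ x b', b = Fin.cons x b' := ⟨b 0, Fin.tail b, (Fin.cons_self_tail b).symm⟩
    change dB (dB (pt (R := R) a (Fin.cons x b))) = 0
    rw [← hB_pt, dB_hB, map_sub, dB_hB, ih, map_zero, sub_zero, sub_self]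

/-- A staircase argument. Subtracting `dA (hA v)` from `v` leaves `hA (dA v)`, which is a `dB`-cycle
because `dB v = dA u`; so it is a `dB`-boundary. With `w₂ = hA v` the chain `u - dB w₂` is then a
`dA`-cycle, hence a `dA`-boundary. -/
lemma exists_dA_dB_eq (a₀ : A) (b₀ : B) (u : Chains R A B (p + 2) (q + 1))
    (v : Chains R A B (p + 1) (q + 2)) (h : dA u - dB v = 0) :
    ∃ w₁ w₂ w₃, dA w₁ + dB w₂ = u ∧ dA w₂ + dB w₃ = v := by
  rw [sub_eq_zero] at h
  have h₃ : dB (hB b₀ (hA a₀ (dA v))) = hA a₀ (dA v) := by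
    rw [dB_hB, dB_hA, ← dA_dB, ← h, dA_dA, map_zero, map_zero, sub_zero]
  have h₂ : dA (hA a₀ v) + dB (hB b₀ (hA a₀ (dA v))) = v := by
    rw [h₃, dA_hA, sub_add_cancel]
  refine ⟨hA a₀ (u - dB (hA a₀ v)), hA a₀ v, hB b₀ (hA a₀ (dA v)), ?_, h₂⟩
  have h₁ : dA (u - dB (hA a₀ v)) = 0 := by
    rw [map_sub, dA_dB, eq_sub_of_add_eq h₂, map_sub, dB_dB, h, sub_zero, sub_self]
  rw [dA_hA, h₁, map_zero, sub_zero, sub_add_cancel]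

/-- The contraction gives `w = dA (hA w) + hA (dA w)`, and the second term is a `dB`-cycle because
`dA (dB w) = 0`. -/
lemma exists_dA_sub_dB_eq (a₀ : A) (b₀ : B) (w : Chains R A B (p + 1) (q + 1))
    (h : dA (dB w) = 0) : ∃ u v, dA u - dB v = w := by
  refine ⟨hA a₀ w, -hB b₀ (hA a₀ (dA w)), ?_⟩
  rw [map_neg, sub_neg_eq_add, dB_hB, dB_hA, ← dA_dB, h, dA_hA]
  simp

lemma exists_dA_dB_eq_of_eq_zero (a₀ : A) (b₀ : B) (z : Chains R A B (p + 1) (q + 1))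
    (hzA : dA z = 0) (hzB : dB z = 0) : ∃ w, dA (dB w) = z := by
  refine ⟨hB b₀ (hA a₀ z), ?_⟩
  rw [dB_hB, dB_hA, hzB, map_zero, map_zero, sub_zero, dA_hA, hzA, map_zero, sub_zero]

end faces

end PermRep

end

noncomputable section

/-! ### A resolution of the augmentation kernel of a disjoint union -/

namespace PermRep

variable {R : Type} [CommRing R]

/-- The map `R[Y] → R[Z]` induced by a map `Y → Z`. -/
def mapLinear {Y Z : Type u} (φ : Y → Z) : MonoidAlgebra R Y →ₗ[R] MonoidAlgebra R Z :=
  linearLift fun y => MonoidAlgebra.single (φ y) 1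

@[simp]
lemma mapLinear_single {Y Z : Type u} (φ : Y → Z) (y : Y) :
    mapLinear φ (MonoidAlgebra.single y (1 : R)) = MonoidAlgebra.single (φ y) 1 :=
  linearLift_single _ _

variable {Γ : Type u} [Group Γ]

lemma mapLinear_ofMulAction {Y Z : Type u} [MulAction Γ Y] [MulAction Γ Z] (φ : Y → Z)
    (hφ : ∀ (g : Γ) y, φ (g • y) = g • φ y) (g : Γ) (z : MonoidAlgebra R Y) :
    mapLinear φ (Representation.ofMulAction R Γ Y g z) =
      Representation.ofMulAction R Γ Z g (mapLinear φ z) := by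
  suffices h : mapLinear φ ∘ₗ Representation.ofMulAction R Γ Y g =
      Representation.ofMulAction R Γ Z g ∘ₗ mapLinear φ from LinearMap.congr_fun h z
  exact linearMap_ext fun y => by simp [hφ]

/-- The inclusion `R[Y] → R[Y ⊔ Z]`. -/
abbrev inlLinear {Y Z : Type u} : MonoidAlgebra R Y →ₗ[R] MonoidAlgebra R (Y ⊕ Z) :=
  mapLinear Sum.inl

/-- The inclusion `R[Z] → R[Y ⊔ Z]`. -/
abbrev inrLinear {Y Z : Type u} : MonoidAlgebra R Z →ₗ[R] MonoidAlgebra R (Y ⊕ Z) :=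
  mapLinear Sum.inr

lemma inlLinear_ofMulAction {Y Z : Type u} [MulAction Γ Y] [MulAction Γ Z] (g : Γ)
    (z : MonoidAlgebra R Y) : inlLinear (Z := Z) (Representation.ofMulAction R Γ Y g z) =
      Representation.ofMulAction R Γ (Y ⊕ Z) g (inlLinear z) :=
  mapLinear_ofMulAction _ (fun _ _ => rfl) g z

lemma inrLinear_ofMulAction {Y Z : Type u} [MulAction Γ Y] [MulAction Γ Z] (g : Γ)
    (z : MonoidAlgebra R Z) : inrLinear (Y := Y) (Representation.ofMulAction R Γ Z g z) =
      Representation.ofMulAction R Γ (Y ⊕ Z) g (inrLinear z) :=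
  mapLinear_ofMulAction _ (fun _ _ => rfl) g z

lemma exists_eq_inl_add_inr {Y Z : Type u} (z : MonoidAlgebra R (Y ⊕ Z)) :
    ∃ u v, inlLinear u + inrLinear v = z := by
  let p : MonoidAlgebra R (Y ⊕ Z) →ₗ[R] MonoidAlgebra R Y :=
    linearLift (Sum.elim (fun y => MonoidAlgebra.single y 1) 0)
  let q : MonoidAlgebra R (Y ⊕ Z) →ₗ[R] MonoidAlgebra R Z :=
    linearLift (Sum.elim 0 (fun y => MonoidAlgebra.single y 1))
  have h : inlLinear ∘ₗ p + inrLinear ∘ₗ q = LinearMap.id :=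
    linearMap_ext fun y => by rcases y with y | y <;> simp [p, q]
  exact ⟨p z, q z, LinearMap.congr_fun h z⟩

/-! ### The equivariant differentials of the resolution and their exactness. -/

variable {A B : Type u} [MulAction Γ A] [MulAction Γ B] {p q : ℕ}

lemma ofMulAction_pt (g : Γ) (a : Fin p → A) (b : Fin q → B) :
    Representation.ofMulAction R Γ (Tuples A B p q) g (pt a b) = pt (g • a) (g • b) :=
  Representation.ofMulAction_single _ _ _

lemma dA_ofMulAction (g : Γ) (z : Chains R A B (p + 1) q) :
    dA (Representation.ofMulAction R Γ _ g z) = Representation.ofMulAction R Γ _ g (dA z) := by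
  suffices h : dA ∘ₗ Representation.ofMulAction R Γ (Tuples A B (p + 1) q) g =
      Representation.ofMulAction R Γ _ g ∘ₗ dA from LinearMap.congr_fun h z
  refine linearMap_ext fun ⟨a, b⟩ => ?_
  change dA (Representation.ofMulAction R Γ _ g (pt a b)) =
    Representation.ofMulAction R Γ _ g (dA (pt a b))
  simp only [ofMulAction_pt, dA_pt, map_sum, map_smul]
  rfl

lemma dB_ofMulAction (g : Γ) (z : Chains R A B p (q + 1)) :
    dB (Representation.ofMulAction R Γ _ g z) = Representation.ofMulAction R Γ _ g (dB z) := by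
  suffices h : dB ∘ₗ Representation.ofMulAction R Γ (Tuples A B p (q + 1)) g =
      Representation.ofMulAction R Γ _ g ∘ₗ dB from LinearMap.congr_fun h z
  refine linearMap_ext fun ⟨a, b⟩ => ?_
  change dB (Representation.ofMulAction R Γ _ g (pt a b)) =
    Representation.ofMulAction R Γ _ g (dB (pt a b))
  simp only [ofMulAction_pt, dB_pt, map_sum, map_smul]
  rfl

variable (R Γ A B)

/-- The term of degree one of the resolution. -/
abbrev Res₁ : Rep.{u} R Γ := Rep.ofMulAction R Γ (Tuples A B 2 2)

/-- The term of degree zero of the resolution. -/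
abbrev Res₀ : Rep.{u} R Γ := Rep.ofMulAction R Γ (Tuples A B 1 1)

/-- The term of degree two of the resolution. -/
abbrev Res₂ : Rep.{u} R Γ := Rep.ofMulAction R Γ (Tuples A B 3 2 ⊕ Tuples A B 2 3)

/-- The term of degree three of the resolution. -/
abbrev Res₃ : Rep.{u} R Γ :=
  Rep.ofMulAction R Γ (Tuples A B 4 2 ⊕ (Tuples A B 3 3 ⊕ Tuples A B 2 4))

/-- The linear map underlying `d₃`. -/
def d₃Linear : MonoidAlgebra R (Tuples A B 4 2 ⊕ (Tuples A B 3 3 ⊕ Tuples A B 2 4)) →ₗ[R]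
    MonoidAlgebra R (Tuples A B 3 2 ⊕ Tuples A B 2 3) :=
  linearLift (Sum.elim (fun y => inlLinear (dA (pt y.1 y.2))) (Sum.elim
    (fun y => inlLinear (dB (pt y.1 y.2)) + inrLinear (dA (pt y.1 y.2)))
    (fun y => inrLinear (dB (pt y.1 y.2)))))

/-- The linear map underlying `d₂`. -/
def d₂Linear : MonoidAlgebra R (Tuples A B 3 2 ⊕ Tuples A B 2 3) →ₗ[R] Chains R A B 2 2 :=
  -- The sign makes the two routes from `C(3, 3)` to `C(2, 2)` cancel.
  linearLift (Sum.elim (fun y => dA (pt y.1 y.2)) (fun y => -dB (pt y.1 y.2)))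

variable {A B}

lemma d₃Linear_left (z : Chains R A B 4 2) :
    d₃Linear R A B (inlLinear z) = inlLinear (dA z) := by
  suffices h : d₃Linear R A B ∘ₗ inlLinear = inlLinear ∘ₗ dA from
    LinearMap.congr_fun h z
  exact linearMap_ext fun y => by simp [d₃Linear]

lemma d₃Linear_middle (z : Chains R A B 3 3) :
    d₃Linear R A B (inrLinear (inlLinear z)) =
      inlLinear (dB z) + inrLinear (dA z) := by
  suffices h : d₃Linear R A B ∘ₗ inrLinear ∘ₗ inlLinear =
      inlLinear ∘ₗ dB + inrLinear ∘ₗ dA from LinearMap.congr_fun h z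
  exact linearMap_ext fun y => by simp [d₃Linear]

lemma d₃Linear_right (z : Chains R A B 2 4) :
    d₃Linear R A B (inrLinear (inrLinear z)) = inrLinear (dB z) := by
  suffices h : d₃Linear R A B ∘ₗ inrLinear ∘ₗ inrLinear =
      inrLinear ∘ₗ dB from LinearMap.congr_fun h z
  exact linearMap_ext fun y => by simp [d₃Linear]

lemma d₂Linear_left (z : Chains R A B 3 2) : d₂Linear R A B (inlLinear z) = dA z := by
  suffices h : d₂Linear R A B ∘ₗ inlLinear = dA from LinearMap.congr_fun h z
  exact linearMap_ext fun y => by simp [d₂Linear]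

lemma d₂Linear_right (z : Chains R A B 2 3) : d₂Linear R A B (inrLinear z) = -dB z := by
  suffices h : d₂Linear R A B ∘ₗ inrLinear = -dB from LinearMap.congr_fun h z
  exact linearMap_ext fun y => by simp [d₂Linear]

variable (A B)

/-- The differential of degree three. -/
def d₃ : Res₃ R Γ A B ⟶ Res₂ R Γ A B :=
  lift (fun y => d₃Linear R A B (MonoidAlgebra.single y 1)) fun g y => by
    rcases y with y | y | y <;>
    simp only [d₃Linear, Sum.smul_inl, Sum.smul_inr, linearLift_single, Sum.elim_inl, Sum.elim_inr,
      map_add, Prod.smul_fst, Prod.smul_snd, ← ofMulAction_pt, dA_ofMulAction, dB_ofMulAction] <;>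
    simp only [inlLinear_ofMulAction, inrLinear_ofMulAction]

/-- The differential of degree two. -/
def d₂ : Res₂ R Γ A B ⟶ Res₁ R Γ A B :=
  lift (fun y => d₂Linear R A B (MonoidAlgebra.single y 1)) fun g y => by
    rcases y with y | y <;>
    simp only [d₂Linear, Sum.smul_inl, Sum.smul_inr, linearLift_single, Sum.elim_inl, Sum.elim_inr,
      map_neg, Prod.smul_fst, Prod.smul_snd, ← ofMulAction_pt, dA_ofMulAction, dB_ofMulAction]

/-- The differential of degree one. -/
def d₁ : Res₁ R Γ A B ⟶ Res₀ R Γ A B :=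
  lift (fun y => dA (dB (pt y.1 y.2))) fun g y => by
    simp only [Prod.smul_fst, Prod.smul_snd, ← ofMulAction_pt, dA_ofMulAction, dB_ofMulAction]

variable {A B}

lemma linearLift_comp_single {Y W : Type*} [AddCommGroup W] [Module R W]
    (f : MonoidAlgebra R Y →ₗ[R] W) (z : MonoidAlgebra R Y) :
    linearLift (fun y => f (MonoidAlgebra.single y 1)) z = f z :=
  LinearMap.congr_fun (linearMap_ext fun y => by simp) z

lemma d₃_apply (z : Res₃ R Γ A B) : (d₃ R Γ A B).hom z = d₃Linear R A B z :=
  linearLift_comp_single R (d₃Linear R A B) z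

lemma d₂_apply (z : Res₂ R Γ A B) : (d₂ R Γ A B).hom z = d₂Linear R A B z :=
  linearLift_comp_single R (d₂Linear R A B) z

lemma d₁_apply (z : Res₁ R Γ A B) : (d₁ R Γ A B).hom z = dA (dB z) :=
  linearLift_comp_single R (dA ∘ₗ dB) z

variable (A B)

lemma d₃_comp_d₂ : d₃ R Γ A B ≫ d₂ R Γ A B = 0 := by
  refine Rep.hom_ext (Representation.IntertwiningMap.ext (LinearMap.ext fun z => ?_))
  change (d₂ R Γ A B).hom ((d₃ R Γ A B).hom z) = 0
  rw [d₃_apply, d₂_apply]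
  obtain ⟨w₁, w, rfl⟩ := exists_eq_inl_add_inr z
  obtain ⟨w₂, w₃, rfl⟩ := exists_eq_inl_add_inr w
  simp only [map_add, d₃Linear_left, d₃Linear_middle, d₃Linear_right, d₂Linear_left,
    d₂Linear_right, dA_dA, dB_dB, dA_dB]
  simp

lemma d₂_comp_d₁ : d₂ R Γ A B ≫ d₁ R Γ A B = 0 := by
  refine Rep.hom_ext (Representation.IntertwiningMap.ext (LinearMap.ext fun z => ?_))
  change (d₁ R Γ A B).hom ((d₂ R Γ A B).hom z) = 0
  rw [d₂_apply, d₁_apply]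
  obtain ⟨u, v, rfl⟩ := exists_eq_inl_add_inr z
  simp only [map_add, map_neg, d₂Linear_left, d₂Linear_right, dB_dB, ← dA_dB, dA_dA]
  simp

lemma exact_d₃_d₂ [Nonempty A] [Nonempty B] :
    (ShortComplex.mk (d₃ R Γ A B) (d₂ R Γ A B) (d₃_comp_d₂ R Γ A B)).Exact := by
  refine (exact_iff _).2 fun z hz => ?_
  obtain ⟨u, v, rfl⟩ := exists_eq_inl_add_inr z
  change (d₂ R Γ A B).hom _ = 0 at hz
  rw [d₂_apply, map_add, d₂Linear_left, d₂Linear_right, ← sub_eq_add_neg] at hz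
  obtain ⟨w₁, w₂, w₃, hu, hv⟩ :=
    exists_dA_dB_eq (Classical.arbitrary A) (Classical.arbitrary B) u v hz
  refine ⟨inlLinear w₁ + (inrLinear (inlLinear w₂) +
    inrLinear (inrLinear w₃)), ?_⟩
  change (d₃ R Γ A B).hom _ = _
  rw [d₃_apply, map_add, map_add, d₃Linear_left, d₃Linear_middle, d₃Linear_right, ← hu, ← hv,
    map_add, map_add]
  abel

lemma exact_d₂_d₁ [Nonempty A] [Nonempty B] :
    (ShortComplex.mk (d₂ R Γ A B) (d₁ R Γ A B) (d₂_comp_d₁ R Γ A B)).Exact := by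
  refine (exact_iff _).2 fun z hz => ?_
  change (d₁ R Γ A B).hom _ = 0 at hz
  rw [d₁_apply] at hz
  obtain ⟨u, v, h⟩ :=
    exists_dA_sub_dB_eq (Classical.arbitrary A) (Classical.arbitrary B) z hz
  refine ⟨inlLinear u + inrLinear v, ?_⟩
  change (d₂ R Γ A B).hom _ = _
  rw [d₂_apply, map_add, d₂Linear_left, d₂Linear_right, ← sub_eq_add_neg, h]

/-! ### The augmentation -/

variable {A B} {X : Type u} [MulAction Γ X] (ξ : A ⊕ B ≃ X) (hξ : ∀ (g : Γ) p, ξ (g • p) = g • ξ p)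

variable {Γ} in
/-- The map `R[A × B] → R[A ⊔ B]`, `(a, b) ↦ a - b`. -/
def d₀ : Res₀ R Γ A B ⟶ Rep.ofMulAction R Γ X :=
  lift (fun y => (MonoidAlgebra.single (ξ (.inl (y.1 0))) 1 -
    MonoidAlgebra.single (ξ (.inr (y.2 0))) 1 : MonoidAlgebra R X)) fun g y => by
      simp [← hξ]

/-- The map `R[A] → R[A ⊔ B]`. -/
def fstLinear : Chains R A B 1 0 →ₗ[R] MonoidAlgebra R X :=
  linearLift fun y => MonoidAlgebra.single (ξ (.inl (y.1 0))) 1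

/-- The map `R[B] → R[A ⊔ B]`. -/
def sndLinear : Chains R A B 0 1 →ₗ[R] MonoidAlgebra R X :=
  linearLift fun y => MonoidAlgebra.single (ξ (.inr (y.2 0))) 1

/-- On `C(1, 1)` the face map `dB` forgets the entry in `B` and `dA` the entry in `A`. In this form
`d₁ ≫ d₀ = 0` follows from `dA² = dB² = 0`. -/
lemma d₀_apply (z : Res₀ R Γ A B) :
    (d₀ R ξ hξ).hom z = fstLinear R ξ (dB z) - sndLinear R ξ (dA z) := by
  suffices h : (d₀ R ξ hξ).hom.toLinearMap = fstLinear R ξ ∘ₗ dB - sndLinear R ξ ∘ₗ dA from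
    LinearMap.congr_fun h z
  refine linearMap_ext fun ⟨a, b⟩ => ?_
  refine (value_lift _ _ _).trans ?_
  change _ = fstLinear R ξ (dB (pt a b)) - sndLinear R ξ (dA (pt a b))
  simp [dA_pt, dB_pt, fstLinear, sndLinear]

lemma d₁_comp_d₀ : d₁ R Γ A B ≫ d₀ R ξ hξ = 0 := by
  refine Rep.hom_ext (Representation.IntertwiningMap.ext (LinearMap.ext fun z => ?_))
  change (d₀ R ξ hξ).hom ((d₁ R Γ A B).hom z) = 0
  rw [d₁_apply, d₀_apply, dA_dA, dA_dB, dB_dB, map_zero, map_zero, sub_zero]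

lemma exact_d₁_d₀ [Nonempty A] [Nonempty B] :
    (ShortComplex.mk (d₁ R Γ A B) (d₀ R ξ hξ) (d₁_comp_d₀ R Γ ξ hξ)).Exact := by
  refine (exact_iff _).2 fun z hz => ?_
  change (d₀ R ξ hξ).hom z = 0 at hz
  have hB' : dB (z : Chains R A B 1 1) = 0 := by
    -- `r` is the projection `R[X] → R[A]`. Its composite with `d₀` is `dB`, so `d₀ z = 0` forces
    -- `dB z = 0`.
    let r : MonoidAlgebra R X →ₗ[R] Chains R A B 1 0 := linearLift fun x =>
      Sum.elim (fun a => pt (fun _ => a) Fin.elim0) (fun _ => 0) (ξ.symm x)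
    have hr : r ∘ₗ (d₀ R ξ hξ).hom.toLinearMap = dB := by
      refine linearMap_ext fun ⟨a, b⟩ => ?_
      refine (congrArg r (value_lift _ _ _)).trans ?_
      change _ = dB (pt a b)
      rw [map_sub, linearLift_single, linearLift_single]
      simp only [Equiv.symm_apply_apply, Sum.elim_inl, Sum.elim_inr, dB_pt]
      simp
      exact congrArg₂ pt (funext fun i => congrArg a (Subsingleton.elim _ _))
        (Subsingleton.elim _ _)
    rw [← LinearMap.congr_fun hr z]
    exact (congrArg r hz).trans (map_zero r)
  have hA' : dA (z : Chains R A B 1 1) = 0 := by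
    -- Likewise for `B`; the sign compensates the one in `(a, b) ↦ a - b`.
    let r : MonoidAlgebra R X →ₗ[R] Chains R A B 0 1 := linearLift fun x =>
      Sum.elim (fun _ => 0) (fun b => -pt Fin.elim0 (fun _ => b)) (ξ.symm x)
    have hr : r ∘ₗ (d₀ R ξ hξ).hom.toLinearMap = dA := by
      refine linearMap_ext fun ⟨a, b⟩ => ?_
      refine (congrArg r (value_lift _ _ _)).trans ?_
      change _ = dA (pt a b)
      rw [map_sub, linearLift_single, linearLift_single]
      simp only [Equiv.symm_apply_apply, Sum.elim_inl, Sum.elim_inr, dA_pt]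
      simp
      exact congrArg₂ pt (Subsingleton.elim _ _)
        (funext fun i => congrArg b (Subsingleton.elim _ _))
    rw [← LinearMap.congr_fun hr z]
    exact (congrArg r hz).trans (map_zero r)
  obtain ⟨w, hw⟩ :=
    exists_dA_dB_eq_of_eq_zero (Classical.arbitrary A) (Classical.arbitrary B) z hA' hB'
  exact ⟨w, (d₁_apply R Γ w).trans hw⟩

lemma exists_d₀_eq [Nonempty A] [Nonempty B] (z : Rep.ofMulAction R Γ X)
    (hz : linearLift (fun _ => (1 : R)) z = 0) : ∃ w, (d₀ R ξ hξ).hom w = z := by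
  let a₀ := Classical.arbitrary A
  let b₀ := Classical.arbitrary B
  -- `D` is chosen so that `d₀ (D x) = x - b₀` for every point `x`, the points of `B` being reached
  -- through `(a₀ - b₀) - (a₀ - b)`. On the augmentation kernel the multiples of `b₀` add up to
  -- zero.
  let D : MonoidAlgebra R X →ₗ[R] Chains R A B 1 1 := linearLift fun x =>
    Sum.elim (fun a => pt (fun _ => a) (fun _ => b₀))
      (fun b => pt (fun _ => a₀) (fun _ => b₀) - pt (fun _ => a₀) (fun _ => b)) (ξ.symm x)
  have hd : ∀ a b, (d₀ R ξ hξ).hom (pt a b) = (MonoidAlgebra.single (ξ (.inl (a 0))) 1 -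
      MonoidAlgebra.single (ξ (.inr (b 0))) 1 : MonoidAlgebra R X) := fun a b => value_lift _ _ _
  have h : (d₀ R ξ hξ).hom.toLinearMap ∘ₗ D = LinearMap.id -
      (linearLift fun _ => (1 : R)).smulRight (MonoidAlgebra.single (ξ (.inr b₀)) (1 : R)) := by
    refine linearMap_ext fun x => ?_
    obtain ⟨p, rfl⟩ := ξ.surjective x
    change (d₀ R ξ hξ).hom (D _) = MonoidAlgebra.single (ξ p) 1 - linearLift (fun _ => (1 : R))
      (MonoidAlgebra.single (ξ p) (1 : R)) • MonoidAlgebra.single (ξ (.inr b₀)) (1 : R)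
    rw [linearLift_single, linearLift_single, one_smul, Equiv.symm_apply_apply]
    rcases p with a | b
    · exact hd _ _
    · refine (map_sub _ _ _).trans ?_
      rw [hd, hd, sub_sub_sub_cancel_left]
  refine ⟨D z, (LinearMap.congr_fun h z).trans ?_⟩
  change z - linearLift (fun _ => (1 : R)) z • _ = z
  rw [hz, zero_smul, sub_zero]

end PermRep

end

noncomputable section

/-! ### Alternating faces of short tuples -/

namespace PermRep

variable {R : Type} [CommRing R] {A B : Type u} {p q : ℕ}

lemma dA_pt_three (x y z : A) (b : Fin q → B) :
    dA (pt (R := R) ![x, y, z] b) = pt ![y, z] b - pt ![x, z] b + pt ![x, y] b := by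
  have h0 : ![x, y, z] ∘ (0 : Fin 3).succAbove = ![y, z] := by funext i; fin_cases i <;> rfl
  have h1 : ![x, y, z] ∘ (1 : Fin 3).succAbove = ![x, z] := by funext i; fin_cases i <;> rfl
  have h2 : ![x, y, z] ∘ (2 : Fin 3).succAbove = ![x, y] := by funext i; fin_cases i <;> rfl
  rw [dA_pt, Fin.sum_univ_three, h0, h1, h2]
  simp only [Fin.val_zero, Fin.val_one, Fin.val_two, pow_zero, pow_one, one_smul, neg_smul,
    even_two, Even.neg_pow, one_pow, sub_eq_add_neg]

lemma dB_pt_three (a : Fin p → A) (x y z : B) :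
    dB (pt (R := R) a ![x, y, z]) = pt a ![y, z] - pt a ![x, z] + pt a ![x, y] := by
  have h0 : ![x, y, z] ∘ (0 : Fin 3).succAbove = ![y, z] := by funext i; fin_cases i <;> rfl
  have h1 : ![x, y, z] ∘ (1 : Fin 3).succAbove = ![x, z] := by funext i; fin_cases i <;> rfl
  have h2 : ![x, y, z] ∘ (2 : Fin 3).succAbove = ![x, y] := by funext i; fin_cases i <;> rfl
  rw [dB_pt, Fin.sum_univ_three, h0, h1, h2]
  simp only [Fin.val_zero, Fin.val_one, Fin.val_two, pow_zero, pow_one, one_smul, neg_smul,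
    even_two, Even.neg_pow, one_pow, sub_eq_add_neg]

lemma dA_pt_four (w x y z : A) (b : Fin q → B) : dA (pt (R := R) ![w, x, y, z] b) =
    pt ![x, y, z] b - pt ![w, y, z] b + pt ![w, x, z] b - pt ![w, x, y] b := by
  have h0 : ![w, x, y, z] ∘ (0 : Fin 4).succAbove = ![x, y, z] := by funext i; fin_cases i <;> rfl
  have h1 : ![w, x, y, z] ∘ (1 : Fin 4).succAbove = ![w, y, z] := by funext i; fin_cases i <;> rfl
  have h2 : ![w, x, y, z] ∘ (2 : Fin 4).succAbove = ![w, x, z] := by funext i; fin_cases i <;> rfl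
  have h3 : ![w, x, y, z] ∘ (3 : Fin 4).succAbove = ![w, x, y] := by funext i; fin_cases i <;> rfl
  rw [dA_pt, Fin.sum_univ_four, h0, h1, h2, h3]
  have h : ((3 : Fin 4) : ℕ) = 2 + 1 := rfl
  simp only [Fin.val_zero, Fin.val_one, Fin.val_two, h, pow_zero, one_smul, neg_smul,
    pow_succ, mul_neg, mul_one, neg_neg, sub_eq_add_neg]

lemma dB_pt_four (a : Fin p → A) (w x y z : B) : dB (pt (R := R) a ![w, x, y, z]) =
    pt a ![x, y, z] - pt a ![w, y, z] + pt a ![w, x, z] - pt a ![w, x, y] := by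
  have h0 : ![w, x, y, z] ∘ (0 : Fin 4).succAbove = ![x, y, z] := by funext i; fin_cases i <;> rfl
  have h1 : ![w, x, y, z] ∘ (1 : Fin 4).succAbove = ![w, y, z] := by funext i; fin_cases i <;> rfl
  have h2 : ![w, x, y, z] ∘ (2 : Fin 4).succAbove = ![w, x, z] := by funext i; fin_cases i <;> rfl
  have h3 : ![w, x, y, z] ∘ (3 : Fin 4).succAbove = ![w, x, y] := by funext i; fin_cases i <;> rfl
  rw [dB_pt, Fin.sum_univ_four, h0, h1, h2, h3]
  have h : ((3 : Fin 4) : ℕ) = 2 + 1 := rfl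
  simp only [Fin.val_zero, Fin.val_one, Fin.val_two, h, pow_zero, one_smul, neg_smul,
    pow_succ, mul_neg, mul_one, neg_neg, sub_eq_add_neg]

end PermRep

/-! ### Cochains of a matched pair -/

namespace MatchedPair

open PermRep

variable {G F : Type u} [Group G] [Group F] {M : MatchedPair G F}

/-- The action of `F ⋈ G` on `F`. -/
instance actionF : MulAction M.Bowtie F where
  smul a x := a.fst * M.actF a.snd x
  one_smul x := by
    change 1 * M.actF 1 x = x
    rw [one_mul, M.one_actF]
  mul_smul a b x := by
    change (a * b).fst * M.actF (a * b).snd x = a.fst * M.actF a.snd (b.fst * M.actF b.snd x)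
    simp [M.actF_mul, M.mul_actF, mul_assoc]

/-- The action of `F ⋈ G` on `G`. -/
instance actionG : MulAction M.Bowtie G where
  smul a s := M.actG s a⁻¹.fst * a⁻¹.snd
  one_smul s := by
    change M.actG s (1 : M.Bowtie)⁻¹.fst * (1 : M.Bowtie)⁻¹.snd = s
    rw [inv_one]
    simp [M.actG_one]
  mul_smul a b s := by
    change M.actG s (a * b)⁻¹.fst * (a * b)⁻¹.snd =
      M.actG (M.actG s b⁻¹.fst * b⁻¹.snd) a⁻¹.fst * a⁻¹.snd
    rw [mul_inv_rev, Bowtie.mul_fst, Bowtie.mul_snd, M.actG_mul, M.mul_actG, mul_assoc]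

lemma smulF_def (a : M.Bowtie) (x : F) : a • x = a.fst * M.actF a.snd x := rfl

lemma smulG_def (a : M.Bowtie) (s : G) : a • s = M.actG s a⁻¹.fst * a⁻¹.snd := rfl

variable (M) in
/-- The set `X` is the disjoint union of `F` and `G`. -/
def sumEquivX : F ⊕ G ≃ M.X where
  toFun := Sum.elim X.ofF X.ofG
  invFun p := match p with
    | .ofF x => .inl x
    | .ofG s => .inr s
  left_inv p := by rcases p with x | s <;> rfl
  right_inv p := by rcases p with x | s <;> rfl

lemma sumEquivX_smul (a : M.Bowtie) (p : F ⊕ G) : M.sumEquivX (a • p) = a • M.sumEquivX p := by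
  rcases p with x | s <;> rfl

@[simp] lemma inclF_smulF (x y : F) : Bowtie.inclF M x • y = x * y := by
  simp [smulF_def, Bowtie.inclF, M.one_actF]

@[simp] lemma inclF_inv_smulG (x : F) (s : G) : (Bowtie.inclF M x)⁻¹ • s = M.actG s x := by
  simp [smulG_def, Bowtie.inclF]

@[simp] lemma inclG_smulF (s : G) (y : F) : Bowtie.inclG M s • y = M.actF s y := by
  simp [smulF_def, Bowtie.inclG]

@[simp] lemma inclG_smulG (s t : G) : Bowtie.inclG M s • t = t * s⁻¹ := by
  rw [smulG_def, ← map_inv]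
  simp [Bowtie.inclG, M.actG_one]

/-! ### Simple transitivity of `F ⋈ G` on `F × G`. -/

variable (M) in
/-- The element of `F ⋈ G` that maps `1 ∈ F` to `a` and `1 ∈ G` to `b`. -/
def base (a : F) (b : G) : M.Bowtie := ⟨a, (M.actG b a)⁻¹⟩

lemma base_inv_snd (a : F) (b : G) : (M.base a b)⁻¹.snd = b := by
  simp [base, ← M.actG_mul, M.actG_one]

lemma base_smulF (a : F) (b : G) : M.base a b • (1 : F) = a := by
  simp [smulF_def, base, M.actF_one]

lemma base_smulG (a : F) (b : G) : M.base a b • (1 : G) = b := by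
  rw [smulG_def, base_inv_snd, M.one_actG, one_mul]

/-- The image of `1 ∈ F` is the first component of an element, and the image of `1 ∈ G` is the
second component of its inverse; together they determine the element. With `base` this makes the
action on `F × G` simply transitive. -/
lemma eq_of_smul_eq {g h : M.Bowtie} (hF : g • (1 : F) = h • (1 : F))
    (hG : g • (1 : G) = h • (1 : G)) : g = h := by
  rw [smulF_def, smulF_def, M.actF_one, M.actF_one, mul_one, mul_one] at hF
  rw [smulG_def, smulG_def, M.one_actG, M.one_actG, one_mul, one_mul, Bowtie.inv_snd,
    Bowtie.inv_snd, hF] at hG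
  have h' := congrArg (fun s => (M.actG s h.fst)⁻¹) hG
  simp only [← M.actG_mul, inv_mul_cancel, M.actG_one, inv_inv] at h'
  exact Bowtie.ext hF h'

lemma base_smul (g : M.Bowtie) (a : F) (b : G) : M.base (g • a) (g • b) = g * M.base a b :=
  eq_of_smul_eq (by rw [base_smulF, mul_smul, base_smulF])
    (by rw [base_smulG, mul_smul, base_smulG])

@[simp] lemma base_one : M.base 1 1 = 1 := by
  ext <;> simp [base, M.actG_one]

variable (M) in
/-- The translate of a pair of tuples with both zeroth entries equal to `1`. -/
def normalize {p q : ℕ} (y : Tuples F G (p + 1) (q + 1)) : Tuples F G (p + 1) (q + 1) :=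
  (M.base (y.1 0) (y.2 0))⁻¹ • y

lemma normalize_smul {p q : ℕ} (g : M.Bowtie) (y : Tuples F G (p + 1) (q + 1)) :
    M.normalize (g • y) = M.normalize y := by
  change (M.base (g • y.1 0) (g • y.2 0))⁻¹ • g • y = _
  rw [base_smul, mul_inv_rev, mul_smul, inv_smul_smul]
  rfl

lemma normalize_of_eq_one {p q : ℕ} (y : Tuples F G (p + 1) (q + 1)) (h₁ : y.1 0 = 1)
    (h₂ : y.2 0 = 1) : M.normalize y = y := by
  rw [normalize, h₁, h₂, base_one, inv_one, one_smul]

-- Every orbit of pairs of nonempty tuples contains one whose zeroth entries are `1`, so an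
-- invariant function need only be known on such based pairs.
variable (M) in
lemma exists_based {p q : ℕ} (y : Tuples F G (p + 1) (q + 1)) :
    ∃ (g : M.Bowtie) (a : Fin p → F) (b : Fin q → G), y = g • (Fin.cons 1 a, Fin.cons 1 b) := by
  have h₁ : (M.normalize y).1 0 = 1 := by
    change (M.base (y.1 0) (y.2 0))⁻¹ • y.1 0 = 1
    rw [inv_smul_eq_iff, base_smulF]
  have h₂ : (M.normalize y).2 0 = 1 := by
    change (M.base (y.1 0) (y.2 0))⁻¹ • y.2 0 = 1
    rw [inv_smul_eq_iff, base_smulG]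
  refine ⟨M.base (y.1 0) (y.2 0), Fin.tail (M.normalize y).1, Fin.tail (M.normalize y).2, ?_⟩
  have h : (Fin.cons 1 (Fin.tail (M.normalize y).1), Fin.cons 1 (Fin.tail (M.normalize y).2)) =
      M.normalize y :=
    Prod.ext ((congrArg (fun c => (Fin.cons c _ : Fin (p + 1) → F)) h₁.symm).trans
      (Fin.cons_self_tail _))
      ((congrArg (fun c => (Fin.cons c _ : Fin (q + 1) → G)) h₂.symm).trans (Fin.cons_self_tail _))
  rw [h]
  exact (smul_inv_smul _ _).symm

variable {R : Type} [CommRing R]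

lemma projective_tuples (p q : ℕ) :
    Projective (Rep.ofMulAction R M.Bowtie (Tuples F G (p + 1) (q + 1))) :=
  PermRep.projective (fun y => M.base (y.1 0) (y.2 0)) fun g _ => base_smul g _ _

/-! ### Inhomogeneous coordinates for cochains with trivial coefficients. -/

variable {V : Type u} [AddCommGroup V] [Module R V]

lemma value_smul_trivial {Y : Type u} [MulAction M.Bowtie Y]
    (f : Rep.ofMulAction R M.Bowtie Y ⟶ Rep.trivial R M.Bowtie V) (g : M.Bowtie) (y : Y) :
    value f (g • y) = value f y :=
  value_smul f g y

/-- The function `ν : G × F → V` attached to a cochain of degree one. -/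
def nu (g : Res₁ R M.Bowtie F G ⟶ Rep.trivial R M.Bowtie V) (s : G) (x : F) : V :=
  value g (![1, x], ![1, s])

/-- The function `σ : G × F × F → V` attached to a cochain of degree two. -/
def sigma (f : Res₂ R M.Bowtie F G ⟶ Rep.trivial R M.Bowtie V) (s : G) (x y : F) : V :=
  value f (.inl (![1, x, x * y], ![1, s]))

/-- The function `τ : G × G × F → V` attached to a cochain of degree two. -/
def tau (f : Res₂ R M.Bowtie F G ⟶ Rep.trivial R M.Bowtie V) (s t : G) (x : F) : V :=
  value f (.inr (![1, x], ![1, t, s * t]))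

lemma exists_nu_eq (ν : G → F → V) :
    ∃ g : Res₁ R M.Bowtie F G ⟶ Rep.trivial R M.Bowtie V, ∀ s x, nu g s x = ν s x := by
  refine ⟨lift (fun y => ν ((M.normalize y).2 1) ((M.normalize y).1 1)) fun g _ => ?_,
    fun s x => ?_⟩
  · rw [normalize_smul]
    rfl
  · rw [nu, value_lift, normalize_of_eq_one _ rfl rfl]
    rfl

lemma exists_sigma_tau_eq (σ : G → F → F → V) (τ : G → G → F → V) :
    ∃ f : Res₂ R M.Bowtie F G ⟶ Rep.trivial R M.Bowtie V,
      (∀ s x y, sigma f s x y = σ s x y) ∧ ∀ s t x, tau f s t x = τ s t x := by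
  -- The coordinates are read off from a based pair: `y` is recovered from `(1, x, xy)` as `x⁻¹
  -- (xy)`, and `s` from `(1, t, st)` as `(st) t⁻¹`.
  refine ⟨lift (Sum.elim
    (fun y => σ ((M.normalize y).2 1) ((M.normalize y).1 1)
      (((M.normalize y).1 1)⁻¹ * (M.normalize y).1 2))
    (fun y => τ ((M.normalize y).2 2 * ((M.normalize y).2 1)⁻¹) ((M.normalize y).2 1)
      ((M.normalize y).1 1))) fun g y => ?_, fun s x y => ?_, fun s t x => ?_⟩
  · rcases y with y | y <;>
    simp only [Sum.smul_inl, Sum.smul_inr, Sum.elim_inl, Sum.elim_inr, normalize_smul] <;> rfl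
  · rw [sigma, value_lift, Sum.elim_inl, normalize_of_eq_one _ rfl rfl]
    exact congrArg (σ s x) (inv_mul_cancel_left x y)
  · rw [tau, value_lift, Sum.elim_inr, normalize_of_eq_one _ rfl rfl]
    exact congrArg (fun r => τ r t x) (mul_inv_cancel_right s t)

/-- Dropping the leading `1` of an `F`-tuple leaves one that starts with `x`. Translation by `x⁻¹`
makes it based again and sends `s ∈ G` to `s ◁ x`, which is how `◁` enters the cocycle identities.
-/
lemma tuples_eq_inclF_smul₂ (x y : F) (s : G) : ((![x, x * y], ![1, s]) : Tuples F G 2 2) =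
    Bowtie.inclF M x • (![1, y], ![1, M.actG s x]) := by
  rw [← inv_smul_eq_iff]
  refine Prod.ext (funext fun i => ?_) (funext fun i => ?_)
  · change (Bowtie.inclF M x)⁻¹ • ![x, x * y] i = _
    fin_cases i <;> simp [inv_smul_eq_iff]
  · change (Bowtie.inclF M x)⁻¹ • ![1, s] i = _
    fin_cases i <;> simp [M.one_actG]

lemma tuples_eq_inclF_smul₃₂ (x y z : F) (s : G) :
    ((![x, x * y, x * y * z], ![1, s]) : Tuples F G 3 2) =
    Bowtie.inclF M x • (![1, y, y * z], ![1, M.actG s x]) := by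
  rw [← inv_smul_eq_iff]
  refine Prod.ext (funext fun i => ?_) (funext fun i => ?_)
  · change (Bowtie.inclF M x)⁻¹ • ![x, x * y, x * y * z] i = _
    fin_cases i <;> simp [inv_smul_eq_iff, mul_assoc]
  · change (Bowtie.inclF M x)⁻¹ • ![1, s] i = _
    fin_cases i <;> simp [M.one_actG]

lemma tuples_eq_inclF_smul₂₃ (x y : F) (s t : G) :
    ((![x, x * y], ![1, t, s * t]) : Tuples F G 2 3) =
    Bowtie.inclF M x •
      (![1, y], ![1, M.actG t x, M.actG s (M.actF t x) * M.actG t x]) := by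
  rw [← inv_smul_eq_iff]
  refine Prod.ext (funext fun i => ?_) (funext fun i => ?_)
  · change (Bowtie.inclF M x)⁻¹ • ![x, x * y] i = _
    fin_cases i <;> simp [inv_smul_eq_iff]
  · change (Bowtie.inclF M x)⁻¹ • ![1, t, s * t] i = _
    fin_cases i <;> simp [M.one_actG, M.mul_actG]

/-- A `G`-tuple that starts with `t` becomes based under translation by `t`, which acts on `G` by
right multiplication by `t⁻¹` and on `F` by `t ▷`. -/
lemma inclG_smul_tuples₂ (x : F) (s t : G) :
    Bowtie.inclG M t • ((![1, x], ![t, s * t]) : Tuples F G 2 2) =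
      (![1, M.actF t x], ![1, s]) := by
  refine Prod.ext (funext fun i => ?_) (funext fun i => ?_)
  · change Bowtie.inclG M t • ![1, x] i = _
    fin_cases i <;> simp [M.actF_one]
  · change Bowtie.inclG M t • ![t, s * t] i = _
    fin_cases i <;> simp

lemma inclG_smul_tuples₃₂ (x y : F) (s t : G) :
    Bowtie.inclG M t • ((![1, x, x * y], ![t, s * t]) : Tuples F G 3 2) =
      (![1, M.actF t x, M.actF t x * M.actF (M.actG t x) y], ![1, s]) := by
  refine Prod.ext (funext fun i => ?_) (funext fun i => ?_)
  · change Bowtie.inclG M t • ![1, x, x * y] i = _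
    fin_cases i <;> simp [M.actF_one, M.actF_mul]
  · change Bowtie.inclG M t • ![t, s * t] i = _
    fin_cases i <;> simp

lemma inclG_smul_tuples₂₃ (x : F) (r s t : G) :
    Bowtie.inclG M t • ((![1, x], ![t, s * t, r * s * t]) : Tuples F G 2 3) =
      (![1, M.actF t x], ![1, s, r * s]) := by
  refine Prod.ext (funext fun i => ?_) (funext fun i => ?_)
  · change Bowtie.inclG M t • ![1, x] i = _
    fin_cases i <;> simp [M.actF_one]
  · change Bowtie.inclG M t • ![t, s * t, r * s * t] i = _
    fin_cases i <;> simp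

section coboundary

variable (g : Res₁ R M.Bowtie F G ⟶ Rep.trivial R M.Bowtie V)

lemma sigma_d₂_comp (s : G) (x y : F) : sigma (d₂ R M.Bowtie F G ≫ g) s x y =
    nu g (M.actG s x) y - nu g s (x * y) + nu g s x := by
  have h : sigma (d₂ R M.Bowtie F G ≫ g) s x y =
      g.hom.toLinearMap (dA (pt ![1, x, x * y] ![1, s])) :=
    congrArg g.hom ((value_lift _ _ _).trans (linearLift_single _ _))
  rw [h, dA_pt_three, map_add, map_sub]
  refine congrArg (fun v => v - nu g s (x * y) + nu g s x) ?_
  change value g (![x, x * y], ![1, s]) = _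
  rw [tuples_eq_inclF_smul₂, value_smul_trivial]
  rfl

/-- The outer sign is that of `dB` in `d₂`. It matches `Cocycle.equivalent_iff`, where `ν` enters
the relation for `τ` inversely to the one for `σ`. -/
lemma tau_d₂_comp (s t : G) (x : F) : tau (d₂ R M.Bowtie F G ≫ g) s t x =
    -(nu g s (M.actF t x) - nu g (s * t) x + nu g t x) := by
  have h : tau (d₂ R M.Bowtie F G ≫ g) s t x =
      g.hom.toLinearMap (-dB (pt ![1, x] ![1, t, s * t])) :=
    congrArg g.hom ((value_lift _ _ _).trans (linearLift_single _ _))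
  rw [h, dB_pt_three, map_neg, map_add, map_sub]
  refine congrArg (fun v => -(v - nu g (s * t) x + nu g t x)) ?_
  change value g (![1, x], ![t, s * t]) = _
  rw [← value_smul_trivial g (Bowtie.inclG M t), inclG_smul_tuples₂]
  rfl

end coboundary

section cocycle

variable (f : Res₂ R M.Bowtie F G ⟶ Rep.trivial R M.Bowtie V)

/-- The three summands of `Res₃` yield the three identities of `Cocycle`: this one the cocycle
identity of `σ`, the middle one the compatibility, and the right one the cocycle identity of `τ`. In
each, only the zeroth faces need to be translated back to based pairs. -/
lemma value_d₃_comp_left (s : G) (x y z : F) :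
    value (d₃ R M.Bowtie F G ≫ f) (.inl (![1, x, x * y, x * y * z], ![1, s])) =
      sigma f (M.actG s x) y z - sigma f s (x * y) z + sigma f s x (y * z) - sigma f s x y := by
  have h : value (d₃ R M.Bowtie F G ≫ f) (.inl (![1, x, x * y, x * y * z], ![1, s])) =
      f.hom.toLinearMap (inlLinear (dA (pt ![1, x, x * y, x * y * z] ![1, s]))) :=
    congrArg f.hom ((value_lift _ _ _).trans (linearLift_single _ _))
  rw [h, dA_pt_four]
  simp only [map_add, map_sub, mapLinear_single, pt]
  change value f (.inl (![x, x * y, x * y * z], ![1, s])) -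
    value f (.inl (![1, x * y, x * y * z], ![1, s])) +
    value f (.inl (![1, x, x * y * z], ![1, s])) - value f (.inl (![1, x, x * y], ![1, s])) = _
  rw [tuples_eq_inclF_smul₃₂ (M := M), ← Sum.smul_inl, value_smul_trivial]
  simp only [sigma, mul_assoc]

lemma value_d₃_comp_middle (s t : G) (x y : F) :
    value (d₃ R M.Bowtie F G ≫ f) (.inr (.inl (![1, x, x * y], ![1, t, s * t]))) =
      (sigma f s (M.actF t x) (M.actF (M.actG t x) y) - sigma f (s * t) x y + sigma f t x y) +
      (tau f (M.actG s (M.actF t x)) (M.actG t x) y - tau f s t (x * y) + tau f s t x) := by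
  have h : value (d₃ R M.Bowtie F G ≫ f) (.inr (.inl (![1, x, x * y], ![1, t, s * t]))) =
      f.hom.toLinearMap (inlLinear (dB (pt ![1, x, x * y] ![1, t, s * t])) +
        inrLinear (dA (pt ![1, x, x * y] ![1, t, s * t]))) :=
    congrArg f.hom ((value_lift _ _ _).trans (linearLift_single _ _))
  rw [h, dA_pt_three, dB_pt_three]
  simp only [map_add, map_sub, mapLinear_single, pt]
  change value f (.inl (![1, x, x * y], ![t, s * t])) -
    value f (.inl (![1, x, x * y], ![1, s * t])) + value f (.inl (![1, x, x * y], ![1, t])) +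
    (value f (.inr (![x, x * y], ![1, t, s * t])) - value f (.inr (![1, x * y], ![1, t, s * t])) +
      value f (.inr (![1, x], ![1, t, s * t]))) = _
  rw [tuples_eq_inclF_smul₂₃ (M := M), ← Sum.smul_inr, value_smul_trivial,
    ← value_smul_trivial f (Bowtie.inclG M t) (.inl (![1, x, x * y], ![t, s * t])), Sum.smul_inl,
    inclG_smul_tuples₃₂]
  rfl

lemma value_d₃_comp_right (r s t : G) (x : F) :
    value (d₃ R M.Bowtie F G ≫ f) (.inr (.inr (![1, x], ![1, t, s * t, r * s * t]))) =
      tau f r s (M.actF t x) - tau f r (s * t) x + tau f (r * s) t x - tau f s t x := by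
  have h : value (d₃ R M.Bowtie F G ≫ f) (.inr (.inr (![1, x], ![1, t, s * t, r * s * t]))) =
      f.hom.toLinearMap (inrLinear (dB (pt ![1, x] ![1, t, s * t, r * s * t]))) :=
    congrArg f.hom ((value_lift _ _ _).trans (linearLift_single _ _))
  rw [h, dB_pt_four]
  simp only [map_add, map_sub, mapLinear_single, pt]
  change value f (.inr (![1, x], ![t, s * t, r * s * t])) -
    value f (.inr (![1, x], ![1, s * t, r * s * t])) +
    value f (.inr (![1, x], ![1, t, r * s * t])) - value f (.inr (![1, x], ![1, t, s * t])) = _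
  rw [← value_smul_trivial f (Bowtie.inclG M t) (.inr (![1, x], ![t, s * t, r * s * t])),
    Sum.smul_inr, inclG_smul_tuples₂₃]
  simp only [tau, mul_assoc]

lemma hom_ext_sigma_tau {f f' : Res₂ R M.Bowtie F G ⟶ Rep.trivial R M.Bowtie V}
    (hs : ∀ s x y, sigma f s x y = sigma f' s x y) (ht : ∀ s t x, tau f s t x = tau f' s t x) :
    f = f' := by
  refine PermRep.hom_ext fun y => ?_
  rcases y with y | y
  · obtain ⟨g, a, b, rfl⟩ := exists_based M y
    rw [← Sum.smul_inl, value_smul_trivial, value_smul_trivial]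
    -- The inhomogeneous coordinates of the based pair with entries `a` and `b`.
    have h := hs (b 0) (a 0) ((a 0)⁻¹ * a 1)
    rw [sigma, sigma, mul_inv_cancel_left] at h
    have ha : (Fin.cons 1 a : Fin 3 → F) = ![1, a 0, a 1] := by
      funext i; fin_cases i <;> rfl
    have hb : (Fin.cons 1 b : Fin 2 → G) = ![1, b 0] := by
      funext i; fin_cases i <;> rfl
    rw [ha, hb, h]
  · obtain ⟨g, a, b, rfl⟩ := exists_based M y
    rw [← Sum.smul_inr, value_smul_trivial, value_smul_trivial]
    have h := ht (b 1 * (b 0)⁻¹) (b 0) (a 0)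
    rw [tau, tau, inv_mul_cancel_right] at h
    have ha : (Fin.cons 1 a : Fin 2 → F) = ![1, a 0] := by
      funext i; fin_cases i <;> rfl
    have hb : (Fin.cons 1 b : Fin 3 → G) = ![1, b 0, b 1] := by
      funext i; fin_cases i <;> rfl
    rw [ha, hb, h]

lemma d₃_comp_eq_zero
    (h₁ : ∀ s x y z, sigma f (M.actG s x) y z - sigma f s (x * y) z + sigma f s x (y * z) -
      sigma f s x y = 0)
    (h₂ : ∀ s t x y,
      (sigma f s (M.actF t x) (M.actF (M.actG t x) y) - sigma f (s * t) x y + sigma f t x y) +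
      (tau f (M.actG s (M.actF t x)) (M.actG t x) y - tau f s t (x * y) + tau f s t x) = 0)
    (h₃ : ∀ r s t x, tau f r s (M.actF t x) - tau f r (s * t) x + tau f (r * s) t x -
      tau f s t x = 0) :
    d₃ R M.Bowtie F G ≫ f = 0 := by
  refine PermRep.hom_ext fun y => ?_
  rw [value_zero]
  rcases y with y | y | y
  · obtain ⟨g, a, b, rfl⟩ := exists_based M y
    rw [← Sum.smul_inl, value_smul_trivial]
    have h := value_d₃_comp_left f (b 0) (a 0) ((a 0)⁻¹ * a 1) ((a 1)⁻¹ * a 2)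
    rw [h₁, mul_inv_cancel_left, mul_inv_cancel_left] at h
    have ha : (Fin.cons 1 a : Fin 4 → F) = ![1, a 0, a 1, a 2] := by
      funext i; fin_cases i <;> rfl
    have hb : (Fin.cons 1 b : Fin 2 → G) = ![1, b 0] := by
      funext i; fin_cases i <;> rfl
    rw [ha, hb, h]
  · obtain ⟨g, a, b, rfl⟩ := exists_based M y
    rw [← Sum.smul_inl, ← Sum.smul_inr, value_smul_trivial]
    have h := value_d₃_comp_middle f (b 1 * (b 0)⁻¹) (b 0) (a 0) ((a 0)⁻¹ * a 1)
    rw [h₂, mul_inv_cancel_left, inv_mul_cancel_right] at h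
    have ha : (Fin.cons 1 a : Fin 3 → F) = ![1, a 0, a 1] := by
      funext i; fin_cases i <;> rfl
    have hb : (Fin.cons 1 b : Fin 3 → G) = ![1, b 0, b 1] := by
      funext i; fin_cases i <;> rfl
    rw [ha, hb, h]
  · obtain ⟨g, a, b, rfl⟩ := exists_based M y
    rw [← Sum.smul_inr, ← Sum.smul_inr, value_smul_trivial]
    have h := value_d₃_comp_right f (b 2 * (b 1)⁻¹) (b 1 * (b 0)⁻¹) (b 0) (a 0)
    rw [h₃, mul_assoc (b 2 * _), inv_mul_cancel_right, inv_mul_cancel_right] at h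
    have ha : (Fin.cons 1 a : Fin 2 → F) = ![1, a 0] := by
      funext i; fin_cases i <;> rfl
    have hb : (Fin.cons 1 b : Fin 4 → G) = ![1, b 0, b 1, b 2] := by
      funext i; fin_cases i <;> rfl
    rw [ha, hb, h]

end cocycle

end MatchedPair

end

noncomputable section

/-! ### The group `Opext` as an `Ext` group -/

namespace MatchedPair

open PermRep GroupExt

variable {G F : Type u} [Group G] [Group F] (M : MatchedPair G F)

/-! ### Normalization of cocycles of degree two. -/

section

variable {R : Type} [CommRing R] {V : Type u} [AddCommGroup V] [Module R V] {M}

lemma sigma_sub (f g : Res₂ R M.Bowtie F G ⟶ Rep.trivial R M.Bowtie V) (s : G) (x y : F) :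
    sigma (f - g) s x y = sigma f s x y - sigma g s x y := rfl

lemma tau_sub (f g : Res₂ R M.Bowtie F G ⟶ Rep.trivial R M.Bowtie V) (s t : G) (x : F) :
    tau (f - g) s t x = tau f s t x - tau g s t x := rfl

/-- Every cocycle of degree two is cohomologous to a normalized one. -/
lemma exists_normalized (f : Res₂ R M.Bowtie F G ⟶ Rep.trivial R M.Bowtie V)
    (hf : d₃ R M.Bowtie F G ≫ f = 0) : ∃ g : Res₁ R M.Bowtie F G ⟶ Rep.trivial R M.Bowtie V,
      (∀ s, sigma (f - d₂ R M.Bowtie F G ≫ g) s 1 1 = 0) ∧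
      ∀ x, tau (f - d₂ R M.Bowtie F G ≫ g) 1 1 x = 0 := by
  classical
  -- The coboundary of `ν` is `ν(s, 1)` at `σ(s; 1, 1)` and `-ν(1, x)` at `τ(1, 1; x)`, which
  -- dictates these values.
  obtain ⟨g, hg⟩ := exists_nu_eq (M := M) (R := R) fun s x =>
    if x = 1 then sigma f s 1 1 else if s = 1 then -tau f 1 1 x else 0
  -- Both prescriptions apply at `ν(1, 1)`. They agree because compatibility at `1` reads `σ(1; 1,
  -- 1) + τ(1, 1; 1) = 0`.
  have h := value_d₃_comp_middle f 1 1 1 1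
  rw [hf, value_zero] at h
  simp only [M.actF_one, M.one_actG, mul_one, sub_self, zero_add] at h
  refine ⟨g, fun s => ?_, fun x => ?_⟩
  · simp [sigma_sub, sigma_d₂_comp, hg, M.actG_one]
  · simp only [tau_sub, tau_d₂_comp, hg, M.one_actF, mul_one, sub_self, zero_add]
    split_ifs with hx
    · rw [hx, sub_neg_eq_add, add_comm, ← h]
    · simp

/-- With two adjacent arguments equal to `1`, a cocycle identity reduces a value with one argument
`1` to a value of the form `σ(s; 1, 1)` or `τ(1, 1; x)`. -/
lemma sigma_tau_eq_zero (f : Res₂ R M.Bowtie F G ⟶ Rep.trivial R M.Bowtie V)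
    (hf : d₃ R M.Bowtie F G ≫ f = 0) (hs : ∀ s, sigma f s 1 1 = 0) (ht : ∀ x, tau f 1 1 x = 0) :
    (∀ s x, sigma f s 1 x = 0) ∧ (∀ s x, sigma f s x 1 = 0) ∧ (∀ s x, tau f 1 s x = 0) ∧
      ∀ s x, tau f s 1 x = 0 := by
  refine ⟨fun s x => ?_, fun s x => ?_, fun s x => ?_, fun s x => ?_⟩
  · have h := value_d₃_comp_left f s 1 1 x
    rw [hf, value_zero] at h
    simpa [M.actG_one, hs] using h.symm
  · have h := value_d₃_comp_left f s x 1 1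
    rw [hf, value_zero] at h
    simpa [hs] using h.symm
  · have h := value_d₃_comp_right f 1 1 s x
    rw [hf, value_zero] at h
    simpa [ht] using h.symm
  · have h := value_d₃_comp_right f s 1 1 x
    rw [hf, value_zero] at h
    simpa [ht, M.one_actF] using h.symm

end

/-! ### Compatible pairs as normalized cocycles, and equivalence as cohomology. -/

variable (k : Type u) [Field k]

variable {M k} in
/-- The cochain attached to a compatible pair of cocycles. -/
def cochain (c : M.Cocycle k) : Res₂ ℤ M.Bowtie F G ⟶ unitsRep k M.Bowtie :=
  (exists_sigma_tau_eq (M := M) (R := ℤ) (fun s x y => Additive.ofMul (c.σ s x y))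
    fun s t x => Additive.ofMul (c.τ s t x)).choose

section

variable {M k}

lemma sigma_cochain (c : M.Cocycle k) (s : G) (x y : F) :
    sigma (cochain c) s x y = Additive.ofMul (c.σ s x y) :=
  (exists_sigma_tau_eq (M := M) (R := ℤ) (fun s x y => Additive.ofMul (c.σ s x y))
    fun s t x => Additive.ofMul (c.τ s t x)).choose_spec.1 s x y

lemma tau_cochain (c : M.Cocycle k) (s t : G) (x : F) :
    tau (cochain c) s t x = Additive.ofMul (c.τ s t x) :=
  (exists_sigma_tau_eq (M := M) (R := ℤ) (fun s x y => Additive.ofMul (c.σ s x y))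
    fun s t x => Additive.ofMul (c.τ s t x)).choose_spec.2 s t x

lemma d₃_comp_cochain (c : M.Cocycle k) : d₃ ℤ M.Bowtie F G ≫ cochain c = 0 := by
  refine d₃_comp_eq_zero _ (fun s x y z => ?_) (fun s t x y => ?_) fun r s t x => ?_
  · have h := congrArg Additive.ofMul (c.σ_cocycle s x y z)
    rw [ofMul_mul, ofMul_mul] at h
    rw [sigma_cochain, sigma_cochain, sigma_cochain, sigma_cochain, sub_add_eq_add_sub, h]
    abel
  · have h := congrArg Additive.ofMul (c.compat s t x y)
    simp only [ofMul_mul] at h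
    simp only [sigma_cochain, tau_cochain]
    rw [← sub_eq_zero] at h
    rw [← neg_eq_zero, ← h]
    abel
  · have h := congrArg Additive.ofMul (c.τ_cocycle r s t x)
    rw [ofMul_mul, ofMul_mul, ← sub_eq_zero] at h
    rw [tau_cochain, tau_cochain, tau_cochain, tau_cochain, ← h]
    abel

lemma exists_cochain_eq (f : Res₂ ℤ M.Bowtie F G ⟶ unitsRep k M.Bowtie)
    (hf : d₃ ℤ M.Bowtie F G ≫ f = 0) (hs : ∀ s, sigma f s 1 1 = 0) (ht : ∀ x, tau f 1 1 x = 0) :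
    ∃ c : M.Cocycle k, cochain c = f := by
  obtain ⟨h1, h2, h3, h4⟩ := sigma_tau_eq_zero f hf hs ht
  let c : M.Cocycle k :=
    { σ := fun s x y => (sigma f s x y).toMul
      τ := fun s t x => (tau f s t x).toMul
      σ_one_left := fun s x => by rw [h1]; rfl
      σ_one_right := fun s x => by rw [h2]; rfl
      τ_one_left := fun s x => by rw [h3]; rfl
      τ_one_right := fun s x => by rw [h4]; rfl
      σ_cocycle := fun s x y z => by
        have h := value_d₃_comp_left f s x y z
        rw [hf, value_zero] at h
        refine congrArg Additive.toMul
          (a₁ := sigma f (M.actG s x) y z + sigma f s x (y * z))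
          (a₂ := sigma f s x y + sigma f s (x * y) z) (sub_eq_zero.1 ?_)
        rw [h]
        abel
      τ_cocycle := fun r s t x => by
        have h := value_d₃_comp_right f r s t x
        rw [hf, value_zero] at h
        refine congrArg Additive.toMul
          (a₁ := tau f (r * s) t x + tau f r s (M.actF t x))
          (a₂ := tau f r (s * t) x + tau f s t x) (sub_eq_zero.1 ?_)
        rw [h]
        abel
      compat := fun s t x y => by
        have h := value_d₃_comp_middle f s t x y
        rw [hf, value_zero, eq_comm, ← neg_eq_zero] at h
        refine congrArg Additive.toMul
          (a₁ := sigma f (s * t) x y + tau f s t (x * y))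
          (a₂ := sigma f s (M.actF t x) (M.actF (M.actG t x) y) + sigma f t x y +
            (tau f s t x + tau f (M.actG s (M.actF t x)) (M.actG t x) y)) (sub_eq_zero.1 ?_)
        rw [← h]
        abel }
  exact ⟨c, hom_ext_sigma_tau (sigma_cochain c) (tau_cochain c)⟩

variable (M k) in
/-- The homomorphism from compatible pairs of cocycles to cocycles of degree two. -/
def cochainHom :
    Additive (M.Cocycle k) →+ ExtTwo.cocycles (d₃ ℤ M.Bowtie F G) (unitsRep k M.Bowtie) where
  toFun c := ⟨cochain c.toMul, d₃_comp_cochain _⟩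
  map_zero' := by
    refine Subtype.ext (hom_ext_sigma_tau (fun s x y => ?_) fun s t x => ?_)
    · exact (sigma_cochain _ s x y)
    · exact (tau_cochain _ s t x)
  map_add' c d := by
    refine Subtype.ext (hom_ext_sigma_tau (fun s x y => ?_) fun s t x => ?_)
    · refine (sigma_cochain _ s x y).trans ?_
      exact (congrArg₂ (· + ·) (sigma_cochain c.toMul s x y) (sigma_cochain d.toMul s x y)).symm
    · refine (tau_cochain _ s t x).trans ?_
      exact (congrArg₂ (· + ·) (tau_cochain c.toMul s t x) (tau_cochain d.toMul s t x)).symm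

/-- In additive notation the two relations of `Cocycle.equivalent_iff` say that `(σ, τ)` changes by
the coboundary of `ν`. -/
lemma equivalent_iff_exists_d₂ [Fintype G] (c d : M.Cocycle k) : Cocycle.Equivalent c d ↔
    ∃ g, d₂ ℤ M.Bowtie F G ≫ g = cochain c - cochain d := by
  rw [Cocycle.equivalent_iff]
  constructor
  · rintro ⟨ν, -, -, hσ, hτ⟩
    obtain ⟨g, hg⟩ := exists_nu_eq (M := M) (R := ℤ) fun s x => Additive.ofMul (ν s x)
    refine ⟨g, hom_ext_sigma_tau (fun s x y => ?_) fun s t x => ?_⟩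
    · have h := congrArg Additive.ofMul (hσ s x y)
      simp only [ofMul_mul] at h
      rw [sigma_d₂_comp, sigma_sub, sigma_cochain, sigma_cochain, hg, hg, hg, ← sub_eq_zero]
      rw [← sub_eq_zero, ← neg_eq_zero] at h
      rw [← h]
      abel
    · have h := congrArg Additive.ofMul (hτ s t x)
      simp only [ofMul_mul] at h
      rw [tau_d₂_comp, tau_sub, tau_cochain, tau_cochain, hg, hg, hg, ← sub_eq_zero]
      rw [← sub_eq_zero] at h
      rw [← h]
      abel
  · rintro ⟨g, hg⟩
    have hσ : ∀ s x y, nu g (M.actG s x) y - nu g s (x * y) + nu g s x =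
        Additive.ofMul (c.σ s x y) - Additive.ofMul (d.σ s x y) := fun s x y => by
      rw [← sigma_d₂_comp, hg, sigma_sub, sigma_cochain, sigma_cochain]
    have hτ : ∀ s t x, -(nu g s (M.actF t x) - nu g (s * t) x + nu g t x) =
        Additive.ofMul (c.τ s t x) - Additive.ofMul (d.τ s t x) := fun s t x => by
      rw [← tau_d₂_comp, hg, tau_sub, tau_cochain, tau_cochain]
    refine ⟨fun s x => (nu g s x).toMul, fun s => ?_, fun x => ?_, fun s x y => ?_, fun s t x => ?_⟩
    -- The normalization of `ν` is automatic: on normalized cocycles the coboundary relation at `(s;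
    -- 1, 1)` and at `(1, 1; x)` forces `ν(s, 1)` and `ν(1, x)` to be trivial.
    · have h := hσ s 1 1
      rw [M.actG_one, mul_one, sub_self, zero_add, c.σ_one_left, d.σ_one_left, sub_self] at h
      exact congrArg Additive.toMul h
    · have h := hτ 1 1 x
      rw [M.one_actF, mul_one, sub_self, zero_add, c.τ_one_left, d.τ_one_left, sub_self,
        neg_eq_zero] at h
      exact congrArg Additive.toMul h
    · have h := hσ s x y
      refine congrArg Additive.toMul (a₁ := nu g s (x * y) + Additive.ofMul (c.σ s x y))
        (a₂ := nu g s x + nu g (M.actG s x) y + Additive.ofMul (d.σ s x y)) (sub_eq_zero.1 ?_)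
      rw [← sub_eq_zero, ← neg_eq_zero] at h
      rw [← h]
      abel
    · have h := hτ s t x
      refine congrArg Additive.toMul (a₁ := nu g (s * t) x + Additive.ofMul (d.τ s t x))
        (a₂ := nu g s (M.actF t x) + nu g t x + Additive.ofMul (c.τ s t x)) (sub_eq_zero.1 ?_)
      rw [← sub_eq_zero] at h
      rw [← h]
      abel

end

/-! ### The resolution of `Λ_X` -/

lemma augmentation_apply (z : ZX M.Bowtie M.X) :
    (augmentation M.Bowtie M.X).hom z = ULift.up (linearLift (fun _ => (1 : ℤ)) z) := by
  suffices h : (augmentation M.Bowtie M.X).hom.toLinearMap =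
      ULift.moduleEquiv.symm.toLinearMap ∘ₗ linearLift (R := ℤ) (fun _ : M.X => (1 : ℤ)) from
    LinearMap.congr_fun h z
  refine linearMap_ext fun x => (augmentation_single _ _ _ _).trans ?_
  rw [LinearMap.comp_apply, linearLift_single]
  rfl

/-- The differential of degree zero, with values in `ℤ[X]`. -/
abbrev d₀X : Res₀ ℤ M.Bowtie F G ⟶ ZX M.Bowtie M.X := d₀ ℤ M.sumEquivX sumEquivX_smul

lemma d₀X_comp_augmentation : M.d₀X ≫ augmentation M.Bowtie M.X = 0 := by
  refine PermRep.hom_ext fun y => ?_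
  change (augmentation M.Bowtie M.X).hom (value M.d₀X y) = _
  rw [d₀X, d₀, value_lift, augmentation_apply, map_sub, linearLift_single, linearLift_single,
    sub_self]
  rfl

/-- The augmentation of the resolution of `Λ_X`. -/
def d₀Lam : Res₀ ℤ M.Bowtie F G ⟶ Lam M.Bowtie M.X :=
  Limits.kernel.lift _ M.d₀X M.d₀X_comp_augmentation

lemma d₀Lam_comp_ι : M.d₀Lam ≫ Limits.kernel.ι (augmentation M.Bowtie M.X) = M.d₀X :=
  Limits.kernel.lift_ι _ _ _

lemma d₁_comp_d₀Lam : d₁ ℤ M.Bowtie F G ≫ M.d₀Lam = 0 := by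
  rw [← cancel_mono (Limits.kernel.ι (augmentation M.Bowtie M.X)), Category.assoc, d₀Lam_comp_ι,
    Limits.zero_comp]
  exact d₁_comp_d₀ ℤ M.Bowtie _ _

lemma exact_d₁_d₀Lam : (ShortComplex.mk (d₁ ℤ M.Bowtie F G) M.d₀Lam M.d₁_comp_d₀Lam).Exact := by
  let φ : ShortComplex.mk (d₁ ℤ M.Bowtie F G) M.d₀Lam M.d₁_comp_d₀Lam ⟶
      ShortComplex.mk (d₁ ℤ M.Bowtie F G) M.d₀X (d₁_comp_d₀ ℤ M.Bowtie _ _) :=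
    { τ₁ := 𝟙 _
      τ₂ := 𝟙 _
      τ₃ := Limits.kernel.ι (augmentation M.Bowtie M.X)
      comm₂₃ := (Category.id_comp _).trans M.d₀Lam_comp_ι.symm }
  have : Epi φ.τ₁ := inferInstanceAs (Epi (𝟙 _))
  have : IsIso φ.τ₂ := inferInstanceAs (IsIso (𝟙 _))
  have : Mono φ.τ₃ := inferInstanceAs (Mono (Limits.kernel.ι _))
  exact (ShortComplex.exact_iff_of_epi_of_isIso_of_mono φ).2 (exact_d₁_d₀ ℤ M.Bowtie _ _)

instance epi_d₀Lam : Epi M.d₀Lam := by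
  rw [Rep.epi_iff_surjective]
  intro z
  have hz : (augmentation M.Bowtie M.X).hom
      ((Limits.kernel.ι (augmentation M.Bowtie M.X)).hom z) = 0 :=
    congrArg (fun f : Lam M.Bowtie M.X ⟶ Z M.Bowtie => f.hom z)
      (Limits.kernel.condition (augmentation M.Bowtie M.X))
  rw [augmentation_apply] at hz
  obtain ⟨w, hw⟩ := exists_d₀_eq ℤ M.Bowtie M.sumEquivX sumEquivX_smul _ (congrArg ULift.down hz)
  refine ⟨w, (Rep.mono_iff_injective (Limits.kernel.ι (augmentation M.Bowtie M.X))).1 inferInstance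
    (Eq.trans ?_ hw)⟩
  exact congrArg (fun f : Res₀ ℤ M.Bowtie F G ⟶ ZX M.Bowtie M.X => f.hom w) M.d₀Lam_comp_ι

/-- Through the resolution of `Λ_X`, `Ext²` is the group of 2-cocycles modulo coboundaries. Two
compatible pairs have the same class exactly if they are equivalent, and each class contains a
normalized cocycle, which comes from such a pair. -/
theorem nonempty_opext_addEquiv_ext [Fintype G] :
    Nonempty (Additive (M.Opext k) ≃+ Ext.{u} (Lam M.Bowtie M.X) (unitsRep k M.Bowtie) 2) := by
  have := projective_tuples (M := M) (R := ℤ) 0 0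
  have := projective_tuples (M := M) (R := ℤ) 1 1
  obtain ⟨Θ, hΘ, hΘ₀⟩ := ExtTwo.exists_cocycles_surjective (d₃_comp_d₂ ℤ M.Bowtie F G)
    (d₂_comp_d₁ ℤ M.Bowtie F G) M.d₁_comp_d₀Lam (exact_d₃_d₂ ℤ M.Bowtie F G)
    (exact_d₂_d₁ ℤ M.Bowtie F G) M.exact_d₁_d₀Lam (unitsRep k M.Bowtie)
  let Φ := Θ.comp (cochainHom M k)
  have hΦ : ∀ c d : M.Cocycle k, Φ (Additive.ofMul c) = Φ (Additive.ofMul d) ↔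
      Cocycle.Equivalent c d := fun c d => by
    rw [equivalent_iff_exists_d₂, ← sub_eq_zero, ← map_sub]
    exact (hΘ₀ _).trans (by rw [map_sub]; rfl)
  have hΦ' : Function.Surjective Φ := fun e => by
    obtain ⟨⟨f, hf⟩, rfl⟩ := hΘ e
    rw [ExtTwo.mem_cocycles] at hf
    obtain ⟨g, h₁, h₂⟩ := exists_normalized f hf
    have hg : d₃ ℤ M.Bowtie F G ≫ d₂ ℤ M.Bowtie F G ≫ g = 0 := by
      rw [← Category.assoc, d₃_comp_d₂, Limits.zero_comp]
    obtain ⟨c, hc⟩ := exists_cochain_eq (f - d₂ ℤ M.Bowtie F G ≫ g)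
      (by rw [Preadditive.comp_sub, hf, hg, sub_zero]) h₁ h₂
    refine ⟨Additive.ofMul c, ?_⟩
    rw [← sub_eq_zero]
    change Θ _ - Θ _ = 0
    rw [← map_sub, hΘ₀]
    refine ⟨-g, ?_⟩
    change _ = cochain c - f
    rw [hc, Preadditive.comp_neg]
    abel
  let Ψ : M.Opext k →* Multiplicative (Ext.{u} (Lam M.Bowtie M.X) (unitsRep k M.Bowtie) 2) :=
    (Cocycle.equivCon M k).lift (AddMonoidHom.toMultiplicativeRight Φ) fun c d h => (hΦ c d).2 h
  refine ⟨AddEquiv.ofBijective (MonoidHom.toAdditiveLeft Ψ) ⟨fun a b hab => ?_, fun e => ?_⟩⟩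
  · obtain ⟨c, rfl⟩ := Con.mk'_surjective (c := Cocycle.equivCon M k) a
    obtain ⟨d, rfl⟩ := Con.mk'_surjective (c := Cocycle.equivCon M k) b
    exact (Con.eq _).2 ((hΦ c d).1 hab)
  · obtain ⟨c, hc⟩ := hΦ' e
    exact ⟨Additive.ofMul ((c.toMul : M.Cocycle k) : M.Opext k), hc⟩

end MatchedPair

end

noncomputable section

/-! ### Shapiro's lemma -/

namespace ExtAdjunction

open Limits

universe w w₁ w₂ v v₁ v₂ t t₁ t₂

variable {C : Type t} [Category.{v} C] [Abelian C] [HasExt.{w} C]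
  {D₁ : Type t₁} [Category.{v₁} D₁] [Abelian D₁] [HasExt.{w₁} D₁] [EnoughProjectives D₁]
  {D₂ : Type t₂} [Category.{v₂} D₂] [Abelian D₂] [HasExt.{w₂} D₂] [EnoughProjectives D₂]
  {L₁ : D₁ ⥤ C} {R₁ : C ⥤ D₁} [R₁.Additive] [PreservesFiniteLimits R₁] [PreservesFiniteColimits R₁]
  {L₂ : D₂ ⥤ C} {R₂ : C ⥤ D₂} [R₂.Additive] [PreservesFiniteLimits R₂] [PreservesFiniteColimits R₂]
  [L₁.Additive] [L₁.PreservesMonomorphisms] [L₂.Additive] [L₂.PreservesMonomorphisms]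

/-- If `Hom(B, W) ≅ Hom(X₁, R₁ W) × Hom(X₂, R₂ W)` for two exact functors `R₁`, `R₂` whose left
adjoints preserve monomorphisms, then `Ext^n(B, Y) ≅ Ext^n(X₁, R₁ Y) × Ext^n(X₂, R₂ Y)`. -/
theorem prod_unitPullback_bijective (adj₁ : L₁ ⊣ R₁) (adj₂ : L₂ ⊣ R₂) {B : C} {X₁ : D₁} {X₂ : D₂}
    (b₁ : X₁ ⟶ R₁.obj B) (b₂ : X₂ ⟶ R₂.obj B)
    (hb : ∀ W, Function.Bijective fun u : B ⟶ W => (b₁ ≫ R₁.map u, b₂ ≫ R₂.map u)) (Y : C) (n : ℕ) :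
    Function.Bijective ((unitPullback R₁ b₁ Y n).prod (unitPullback R₂ b₂ Y n)) := by
  let c₁ : L₁.obj X₁ ⟶ B := (adj₁.homEquiv _ _).symm b₁
  let c₂ : L₂.obj X₂ ⟶ B := (adj₂.homEquiv _ _).symm b₂
  have h₁ : adj₁.unit.app X₁ ≫ R₁.map c₁ = b₁ := by
    exact (Adjunction.homEquiv_unit _ _ _ _).symm.trans (Equiv.apply_symm_apply _ _)
  have h₂ : adj₂.unit.app X₂ ≫ R₂.map c₂ = b₂ := by
    exact (Adjunction.homEquiv_unit _ _ _ _).symm.trans (Equiv.apply_symm_apply _ _)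
  -- By adjunction and the Yoneda lemma, `hb` says that `B` is `L₁ X₁ ⊞ L₂ X₂`.
  have hβ : IsIso (biprod.desc c₁ c₂) := by
    refine (isIso_iff_coyoneda_map_bijective _).2 fun W => ⟨fun x y hxy => ?_, fun z => ?_⟩
    · refine (hb W).1 (Prod.ext ?_ ?_)
      · have h := congrArg (fun f => biprod.inl ≫ f) hxy
        simp only [biprod.inl_desc_assoc] at h
        simp only [← h₁, Category.assoc, ← Functor.map_comp, h]
      · have h := congrArg (fun f => biprod.inr ≫ f) hxy
        simp only [biprod.inr_desc_assoc] at h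
        simp only [← h₂, Category.assoc, ← Functor.map_comp, h]
    · obtain ⟨x, hx⟩ := (hb W).2
        (adj₁.homEquiv _ _ (biprod.inl ≫ z), adj₂.homEquiv _ _ (biprod.inr ≫ z))
      refine ⟨x, biprod.hom_ext' _ _ ?_ ?_⟩
      · rw [biprod.inl_desc_assoc, ← (adj₁.homEquiv _ _).apply_eq_iff_eq,
          Adjunction.homEquiv_naturality_right, Equiv.apply_symm_apply]
        exact congrArg Prod.fst hx
      · rw [biprod.inr_desc_assoc, ← (adj₂.homEquiv _ _).apply_eq_iff_eq,
          Adjunction.homEquiv_naturality_right, Equiv.apply_symm_apply]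
        exact congrArg Prod.snd hx
  have h : ⇑((unitPullback R₁ b₁ Y n).prod (unitPullback R₂ b₂ Y n)) =
      Prod.map (unitPullback R₁ (adj₁.unit.app X₁) Y n) (unitPullback R₂ (adj₂.unit.app X₂) Y n) ∘
        Ext.biprodAddEquiv ∘ (Ext.mk₀ (biprod.desc c₁ c₂)).precomp Y (zero_add n) := by
    funext e
    refine Prod.ext ?_ ?_
    · change unitPullback R₁ b₁ Y n e = unitPullback R₁ (adj₁.unit.app X₁) Y n
        ((Ext.mk₀ biprod.inl).comp ((Ext.mk₀ (biprod.desc c₁ c₂)).comp e (zero_add n)) (zero_add n))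
      rw [Ext.mk₀_comp_mk₀_assoc, biprod.inl_desc, unitPullback_mk₀_comp, h₁]
    · change unitPullback R₂ b₂ Y n e = unitPullback R₂ (adj₂.unit.app X₂) Y n
        ((Ext.mk₀ biprod.inr).comp ((Ext.mk₀ (biprod.desc c₁ c₂)).comp e (zero_add n)) (zero_add n))
      rw [Ext.mk₀_comp_mk₀_assoc, biprod.inr_desc, unitPullback_mk₀_comp, h₂]
  rw [h]
  refine ((unitPullback_bijective adj₁ X₁ Y n).prodMap (unitPullback_bijective adj₂ X₂ Y n)).comp
    (Ext.biprodAddEquiv.bijective.comp ?_)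
  refine Function.bijective_iff_has_inverse.2
    ⟨(Ext.mk₀ (inv (biprod.desc c₁ c₂))).precomp Y (zero_add n), fun e => ?_, fun e => ?_⟩
  · change (Ext.mk₀ _).comp ((Ext.mk₀ _).comp e (zero_add n)) (zero_add n) = e
    rw [Ext.mk₀_comp_mk₀_assoc, IsIso.inv_hom_id, Ext.mk₀_id_comp]
  · change (Ext.mk₀ _).comp ((Ext.mk₀ _).comp e (zero_add n)) (zero_add n) = e
    rw [Ext.mk₀_comp_mk₀_assoc, IsIso.hom_inv_id, Ext.mk₀_id_comp]

end ExtAdjunction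

/-! ### The two orbits of `X` and their stabilizers. -/

namespace MatchedPair

open PermRep GroupExt ExtAdjunction

variable {G F : Type u} [Group G] [Group F] (M : MatchedPair G F)

/-- An element fixing `1 ∈ F` has first component `1`, so this stabilizer is `G`. -/
lemma exists_eq_mul_inclG {g h : M.Bowtie} (hgh : g • (1 : F) = h • (1 : F)) :
    ∃ s, g = h * Bowtie.inclG M s := by
  rw [← inv_smul_eq_iff, ← mul_smul, smulF_def, M.actF_one, mul_one] at hgh
  exact ⟨(h⁻¹ * g).snd, by rw [← inv_mul_eq_iff_eq_mul]; exact Bowtie.ext hgh rfl⟩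

lemma exists_eq_mul_inclF {g h : M.Bowtie} (hgh : g • (1 : G) = h • (1 : G)) :
    ∃ x, g = h * Bowtie.inclF M x := by
  rw [← inv_smul_eq_iff, ← mul_smul, smulG_def, M.one_actG, one_mul] at hgh
  refine ⟨(h⁻¹ * g)⁻¹.fst⁻¹, ?_⟩
  rw [← inv_mul_eq_iff_eq_mul, map_inv, ← inv_eq_iff_eq_inv]
  exact Bowtie.ext rfl hgh

variable {R : Type} [CommRing R] {W : Rep.{u} R M.Bowtie}

/-- On each orbit of `X` a homomorphism may take any value at the base point that is fixed by the
stabilizer. -/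
lemma exists_value_eq (w₁ w₂ : W) (h₁ : ∀ x, W.ρ (Bowtie.inclF M x) w₁ = w₁)
    (h₂ : ∀ s, W.ρ (Bowtie.inclG M s) w₂ = w₂) :
    ∃ u : Rep.ofMulAction R M.Bowtie M.X ⟶ W, value u (.ofG 1) = w₁ ∧ value u (.ofF 1) = w₂ := by
  -- The element `x ∈ F` carries `1 ∈ F` to `x`, and `s⁻¹ ∈ G` carries `1 ∈ G` to `s`. Other group
  -- elements doing so differ by the stabilizer, which gives equivariance.
  refine ⟨lift (fun p => match p with
    | .ofF x => W.ρ (Bowtie.inclF M x) w₂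
    | .ofG s => W.ρ (Bowtie.inclG M s⁻¹) w₁) fun g p => ?_, ?_, ?_⟩
  · rcases p with x | s
    · obtain ⟨s, hs⟩ := M.exists_eq_mul_inclG (g := Bowtie.inclF M (g • x))
        (h := g * Bowtie.inclF M x) (by simp [mul_smul])
      change W.ρ (Bowtie.inclF M (g • x)) w₂ = _
      rw [hs, map_mul, Module.End.mul_apply, h₂, map_mul, Module.End.mul_apply]
    · obtain ⟨x, hx⟩ := M.exists_eq_mul_inclF (g := Bowtie.inclG M (g • s)⁻¹)
        (h := g * Bowtie.inclG M s⁻¹) (by rw [mul_smul, inclG_smulG, inclG_smulG]; simp)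
      change W.ρ (Bowtie.inclG M (g • s)⁻¹) w₁ = _
      rw [hx, map_mul, Module.End.mul_apply, h₁, map_mul, Module.End.mul_apply]
  · rw [value_lift]
    change W.ρ (Bowtie.inclG M 1⁻¹) w₁ = w₁
    rw [inv_one, map_one, map_one, Module.End.one_apply]
  · rw [value_lift]
    change W.ρ (Bowtie.inclF M 1) w₂ = w₂
    rw [map_one, map_one, Module.End.one_apply]

lemma hom_ext_of_value_one {u u' : Rep.ofMulAction R M.Bowtie M.X ⟶ W}
    (h₁ : value u (.ofG 1) = value u' (.ofG 1)) (h₂ : value u (.ofF 1) = value u' (.ofF 1)) :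
    u = u' := by
  refine PermRep.hom_ext fun p => ?_
  rcases p with x | s
  · have hx : (.ofF x : M.X) = Bowtie.inclF M x • .ofF 1 := by
      rw [smul_ofF]
      simp [Bowtie.inclF, M.one_actF]
    rw [hx, value_smul, value_smul, h₂]
  · have hs : (.ofG s : M.X) = Bowtie.inclG M s⁻¹ • .ofG 1 := by
      rw [smul_ofG, ← map_inv]
      simp [Bowtie.inclG, M.actG_one]
    rw [hs, value_smul, value_smul, h₁]

end MatchedPair

namespace GroupExt

variable {Δ : Type u} [Group Δ]

lemma hom_trivial_ext {R : Type} [CommRing R] {W : Rep.{u} R Δ}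
    {f g : Rep.trivial R Δ (ULift.{u} R) ⟶ W} (h : f.hom (ULift.up 1) = g.hom (ULift.up 1)) :
    f = g := by
  refine Rep.hom_ext (Representation.IntertwiningMap.ext (LinearMap.ext fun n => ?_))
  have hn : n = n.down • (ULift.up 1 : ULift.{u} R) := ULift.ext _ _ (by simp)
  rw [hn]
  exact (map_smul f.hom.toLinearMap _ _).trans
    ((congrArg (n.down • ·) h).trans (map_smul g.hom.toLinearMap _ _).symm)

end GroupExt

namespace MatchedPair

open PermRep GroupExt ExtAdjunction

variable {G F : Type u} [Group G] [Group F] (M : MatchedPair G F)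

/-- Shapiro in degree zero: `Hom(ℤ[X], W)` is `W^F × W^G`. Having it for all `W` is what extends it
to higher `Ext`. -/
lemma pointMap_comp_map_bijective (W : Rep.{u} ℤ M.Bowtie) : Function.Bijective
    fun u : ZX M.Bowtie M.X ⟶ W =>
      (pointMap (Bowtie.inclF M) (X.ofG 1) M.inclF_smul ≫ (Rep.resFunctor (Bowtie.inclF M)).map u,
        pointMap (Bowtie.inclG M) (X.ofF 1) M.inclG_smul ≫
          (Rep.resFunctor (Bowtie.inclG M)).map u) := by
  refine ⟨fun u u' h => ?_, fun ⟨v₁, v₂⟩ => ?_⟩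
  · exact M.hom_ext_of_value_one
      (congrArg (fun v => v.hom (ULift.up 1)) (congrArg Prod.fst h))
      (congrArg (fun v => v.hom (ULift.up 1)) (congrArg Prod.snd h))
  · obtain ⟨u, h₁, h₂⟩ := M.exists_value_eq (W := W) (v₁.hom (ULift.up 1)) (v₂.hom (ULift.up 1))
      (fun x => (Rep.hom_comm_apply v₁ x (ULift.up 1)).symm)
      (fun s => (Rep.hom_comm_apply v₂ s (ULift.up 1)).symm)
    exact ⟨u, Prod.ext (hom_trivial_ext h₁) (hom_trivial_ext h₂)⟩

theorem shapiro_bijective (k : Type u) [Field k] (n : ℕ) : Function.Bijective (M.shapiro k n) := by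
  have adj₁ := Rep.indResAdjunction.{u} ℤ (Bowtie.inclF M)
  have adj₂ := Rep.indResAdjunction.{u} ℤ (Bowtie.inclG M)
  have := adj₁.left_adjoint_additive
  have := adj₂.left_adjoint_additive
  -- Since `(x, s) = (x, 1)(1, s)`, the first component is the left `F`-factor. Factoring `g⁻¹` in
  -- this way and inverting gives the left `G`-factor `g⁻¹.snd⁻¹` used next.
  have := indFunctor_preservesMonomorphisms (R := ℤ) (Bowtie.inclF M) Bowtie.fst fun d g => by
    simp [Bowtie.inclF, M.one_actF]
  have := indFunctor_preservesMonomorphisms (R := ℤ) (Bowtie.inclG M) (fun g => g⁻¹.snd⁻¹)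
    fun d g => by
      rw [mul_inv_rev, ← map_inv, Bowtie.mul_snd]
      simp [Bowtie.inclG, M.actG_one]
  exact prod_unitPullback_bijective adj₁ adj₂ _ _ M.pointMap_comp_map_bijective
    (unitsRep k M.Bowtie) n

end MatchedPair

end

noncomputable section

/-! ### The Kac exact sequence -/

namespace MatchedPair

open PermRep GroupExt ExtAdjunction

variable {G F : Type u} [Group G] [Group F] (M : MatchedPair G F) (k : Type u) [Field k]

/-- The map `H^n(Σ, k^×) → Ext^n(ℤ[X], k^×)` induced by the augmentation. -/
def augPullback (n : ℕ) : H (unitsRep k M.Bowtie) n →+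
    Ext.{u} (ZX M.Bowtie M.X) (unitsRep k M.Bowtie) n :=
  (Ext.mk₀ (augmentation M.Bowtie M.X)).precomp (unitsRep k M.Bowtie) (zero_add n)

lemma pointMap_comp_augmentation {Δ Γ X : Type u} [Group Δ] [Group Γ] [MulAction Γ X] (f : Δ →* Γ)
    (p : X) (hp : ∀ d, f d • p = p) :
    pointMap f p hp ≫ (Rep.resFunctor f).map (augmentation Γ X) = 𝟙 (Z Δ) :=
  hom_trivial_ext (augmentation_single Γ X p 1)

lemma resPullback_augmentation {Δ Γ X : Type u} [Group Δ] [Group Γ] [MulAction Γ X] (f : Δ →* Γ)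
    (V : Type u) [AddCommGroup V] (p : X) (hp : ∀ d, f d • p = p) (n : ℕ)
    (e : H (Rep.trivial ℤ Γ V) n) :
    resPullback f V (pointMap f p hp) n
      ((Ext.mk₀ (augmentation Γ X)).comp e (zero_add n)) = resH f V n e := by
  refine (unitPullback_mk₀_comp (R := Rep.resFunctor f) (pointMap f p hp) (augmentation Γ X)
    (Rep.trivial ℤ Γ V) n e).trans ?_
  rw [pointMap_comp_augmentation]
  rfl

lemma shapiro_augPullback (n : ℕ) (e : H (unitsRep k M.Bowtie) n) :
    M.shapiro k n (M.augPullback k n e) = M.res k n e :=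
  Prod.ext (resPullback_augmentation _ _ _ _ n e) (resPullback_augmentation _ _ _ _ n e)

/-- The Shapiro isomorphism. -/
def shapiroEquiv (n : ℕ) : Ext.{u} (ZX M.Bowtie M.X) (unitsRep k M.Bowtie) n ≃+
    H (unitsRep k F) n × H (unitsRep k G) n :=
  AddEquiv.ofBijective (M.shapiro k n) (M.shapiro_bijective k n)

/-- The map `H^n(F, k^×) ⊕ H^n(G, k^×) → H^{n+1}_𝒜(Σ, X; k^×)`. -/
def toRel (n : ℕ) : H (unitsRep k F) n × H (unitsRep k G) n →+
    HRel M.X (unitsRep k M.Bowtie) (n + 1) :=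
  (inclPullback M.X (unitsRep k M.Bowtie) n).comp (M.shapiroEquiv k n).symm.toAddMonoidHom

lemma toRel_shapiro (n : ℕ) (ξ : Ext.{u} (ZX M.Bowtie M.X) (unitsRep k M.Bowtie) n) :
    M.toRel k n (M.shapiro k n ξ) = inclPullback M.X (unitsRep k M.Bowtie) n ξ :=
  congrArg (inclPullback M.X (unitsRep k M.Bowtie) n) ((M.shapiroEquiv k n).symm_apply_apply ξ)

lemma exact_augPullback_inclPullback (n : ℕ) : Function.Exact (M.augPullback k n)
    (inclPullback M.X (unitsRep k M.Bowtie) n) :=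
  (ShortComplex.ab_exact_iff_function_exact _).1 (Ext.contravariant_sequence_exact₂'
    (augSeq_shortExact M.Bowtie M.X) (unitsRep k M.Bowtie) n)

lemma exact_inclPullback_conn (n : ℕ) : Function.Exact
    (inclPullback M.X (unitsRep k M.Bowtie) n) (conn M.X (unitsRep k M.Bowtie) n) :=
  (ShortComplex.ab_exact_iff_function_exact _).1 (Ext.contravariant_sequence_exact₁'
    (augSeq_shortExact M.Bowtie M.X) (unitsRep k M.Bowtie) n (n + 1) (Nat.add_comm 1 n))

lemma exact_conn_augPullback (n : ℕ) : Function.Exact (conn M.X (unitsRep k M.Bowtie) n)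
    (M.augPullback k (n + 1)) :=
  (ShortComplex.ab_exact_iff_function_exact _).1 (Ext.contravariant_sequence_exact₃'
    (augSeq_shortExact M.Bowtie M.X) (unitsRep k M.Bowtie) n (n + 1) (Nat.add_comm 1 n))

lemma exact_res_toRel (n : ℕ) : Function.Exact (M.res k n) (M.toRel k n) := fun e => by
  obtain ⟨ξ, rfl⟩ := (M.shapiro_bijective k n).2 e
  rw [toRel_shapiro, M.exact_augPullback_inclPullback k n]
  simp only [Set.mem_range, ← shapiro_augPullback, (M.shapiro_bijective k n).1.eq_iff]

lemma exact_toRel_conn (n : ℕ) :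
    Function.Exact (M.toRel k n) (conn M.X (unitsRep k M.Bowtie) n) := fun e => by
  rw [M.exact_inclPullback_conn k n]
  simp only [Set.mem_range, (M.shapiro_bijective k n).2.exists, toRel_shapiro]

lemma exact_conn_res (n : ℕ) :
    Function.Exact (conn M.X (unitsRep k M.Bowtie) n) (M.res k (n + 1)) := fun e => by
  rw [← M.exact_conn_augPullback k n, ← shapiro_augPullback, ← map_zero (M.shapiro k (n + 1)),
    (M.shapiro_bijective k (n + 1)).1.eq_iff]

/-- The translates of `1_F - 1_G` generate `Λ_X` and the target is trivial, so `h` is determined by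
its value there. The extension takes that value at `1 ∈ F` and `0` at `1 ∈ G`. -/
lemma exists_kernel_ι_comp_eq (h : Lam M.Bowtie M.X ⟶ unitsRep k M.Bowtie) :
    ∃ u, Limits.kernel.ι (augmentation M.Bowtie M.X) ≫ u = h := by
  obtain ⟨u, h₁, h₂⟩ := M.exists_value_eq (R := ℤ) (W := unitsRep k M.Bowtie) 0
    (value (M.d₀Lam ≫ h) (Fin.cons 1 Fin.elim0, Fin.cons 1 Fin.elim0)) (fun _ => rfl) fun _ => rfl
  refine ⟨u, ?_⟩
  rw [← cancel_epi M.d₀Lam, ← Category.assoc, d₀Lam_comp_ι]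
  refine PermRep.hom_ext fun y => ?_
  obtain ⟨g, a, b, rfl⟩ := exists_based M y
  rw [value_smul_trivial, value_smul_trivial, value_comp, d₀X, d₀, value_lift]
  refine (map_sub u.hom.toLinearMap _ _).trans ?_
  refine (congrArg₂ (· - ·) h₂ h₁).trans ?_
  rw [sub_zero, Subsingleton.elim a Fin.elim0, Subsingleton.elim b Fin.elim0]

/-- The kernel is the image of the connecting map on `Hom(Λ_X, k^×)`, which kills every homomorphism
that extends to `ℤ[X]`. -/
lemma res_one_injective : Function.Injective (M.res k 1) := by
  refine (injective_iff_map_eq_zero _).2 fun e he => ?_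
  obtain ⟨y, rfl⟩ := (M.exact_conn_res k 0 e).1 he
  obtain ⟨h, rfl⟩ := (Ext.mk₀_bijective _ _).2 y
  exact (ExtTwo.extClass_comp_mk₀_eq_zero_iff (augSeq_shortExact M.Bowtie M.X) h).2
    (M.exists_kernel_ι_comp_eq k h)

end MatchedPair

end

theorem mainTheorem11 {G F : Type u} [Group G] [Group F] [Fintype G] [Fintype F]
    (M : MatchedPair G F) (k : Type u) [Field k] :
    ∃ (φ : Additive (M.Opext k) ≃+ GroupExt.HRel M.X (MatchedPair.unitsRep k M.Bowtie) 3)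
      (δ : ∀ n : ℕ, GroupExt.H (MatchedPair.unitsRep k F) n × GroupExt.H (MatchedPair.unitsRep k G) n
        →+ GroupExt.HRel M.X (MatchedPair.unitsRep k M.Bowtie) (n + 1)),
      (∀ n, Function.Bijective (M.shapiro k n)) ∧
      (∀ n ξ, δ n (M.shapiro k n ξ) =
        GroupExt.inclPullback M.X (MatchedPair.unitsRep k M.Bowtie) n ξ) ∧
      Function.Injective (M.res k 1) ∧
      Function.Exact (M.res k 1) (δ 1) ∧
      Function.Exact (δ 1) (GroupExt.conn M.X (MatchedPair.unitsRep k M.Bowtie) 1) ∧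
      Function.Exact (GroupExt.conn M.X (MatchedPair.unitsRep k M.Bowtie) 1) (M.res k 2) ∧
      Function.Exact (M.res k 2) (φ.symm.toAddMonoidHom.comp (δ 2)) ∧
      Function.Exact (φ.symm.toAddMonoidHom.comp (δ 2))
        ((GroupExt.conn M.X (MatchedPair.unitsRep k M.Bowtie) 2).comp φ.toAddMonoidHom) ∧
      Function.Exact
        ((GroupExt.conn M.X (MatchedPair.unitsRep k M.Bowtie) 2).comp φ.toAddMonoidHom)
        (M.res k 3) ∧
      Function.Exact (M.res k 3) (δ 3) := by
  obtain ⟨φ⟩ := M.nonempty_opext_addEquiv_ext k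
  -- The relative cohomology of degree `3` is by definition `Ext` of degree `3 - 1 = 2`.
  let φ' : Additive (M.Opext k) ≃+ GroupExt.HRel M.X (MatchedPair.unitsRep k M.Bowtie) 3 := φ
  refine ⟨φ', M.toRel k, M.shapiro_bijective k, M.toRel_shapiro k, M.res_one_injective k,
    M.exact_res_toRel k 1, M.exact_toRel_conn k 1, M.exact_conn_res k 1, fun e => ?_, fun e => ?_,
    fun e => ?_, M.exact_res_toRel k 3⟩
  · exact (map_eq_zero_iff φ'.symm φ'.symm.injective).trans (M.exact_res_toRel k 2 e)
  · refine (M.exact_toRel_conn k 2 (φ' e)).trans (exists_congr fun x => ?_)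
    exact φ'.symm_apply_eq.symm
  · refine (M.exact_conn_res k 2 e).trans ⟨?_, ?_⟩
    · rintro ⟨y, rfl⟩
      obtain ⟨c, rfl⟩ := φ'.surjective y
      exact ⟨c, rfl⟩
    · rintro ⟨c, rfl⟩
      exact ⟨φ' c, rfl⟩
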